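/- Let $L,T,\varepsilon>0$, $\Omega=(0,L)^2$, $\beta>0$. Let $f$ be continuously differentiable on an open set $J\supseteq[-\beta,\beta]$ (for example $J=\mathbb R$) with $f(\beta)\le 0\le f(-\beta)$, and let $F'=-f$ on $J$. Put $$E_1(v)=\int_\Omega F(v)\,d\boldsymbol x,\qquad E(v)=\int_\Omega\Big(\tfrac{\varepsilon^2}{2}|\nabla v|^2+F(v)\Big)d\boldsymbol x,$$ and let $C_*\ge 0$ satisfy $|\Omega|\,F(\xi)\ge -C_*$ for all $\xi\in[-\beta,\beta]$. Let $u_e$ be a solution of $u_t=\varepsilon^2\Delta u+f(u)$ on $(0,T)\times\mathbb R^2$ that is $L$-periodic in $x$ and in $y$, is of class $C^4$ in $(t,x,y)$ on $[0,T]\times\mathbb R^2$, and has initial value $u_{\rm init}=u_e(0,\cdot)$ with $\|u_{\rm init}\|_\infty\le\beta$. Put $s_e(t)=E_1(u_e(t))$ and $G^*=\exp\{E(u_{\rm init})+1+C_*\}$. Let $\kappa\ge\|f'\|_{C[-\beta,\beta]}$. For an integer $M\ge1$ let $h=L/M$. On the $M\times M$ periodic grid functions let $\langle v,w\rangle=h^2\sum_{i,j=1}^M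 v_{ij}w_{ij}$, $\|v\|=\langle v,v\rangle^{1/2}$, let $\Delta_h$ be the five-point Laplacian and $\nabla_h$ the forward difference gradient, with $\|\nabla_hv\|^2$ the sum of the squared norms of its two components. Let $E_{1h}(v)=\langle F(v),1\rangle$ and $g(v,s)=\exp\{s\}/\exp\{E_{1h}(v)\}$. For $\tau>0$, the scheme sESAV2 is started by the mesh values $u^0$ of $u_{\rm init}$ and $s^0=E_{1h}(u^0)$. For $n\ge0$ it first computes the predictor $(\widehat u,\widehat s)=(\widehat u^{n+1/2},\widehat s^{n+1/2})$ from $$\frac{\widehat u-u^n}{\tau/2}=\varepsilon^2\Delta_h\widehat u+g(u^n,s^n)f(u^n)-\kappa g(u^n,s^n)(\widehat u-u^n),\qquad \widehat s-s^n=-g(u^n,s^n)\langle f(u^n),\widehat u-u^n\rangle,$$ and then $(u^{n+1},s^{n+1})$ from, with $u^{n+1/2}=\frac{u^{n+1}+u^n}{2}$, $\delta_tu^{n+1}=\frac{u^{n+1}-u^n}{\tau}$ and $\widehat g=g(\widehat u,\widehat s)$, $$\delta_tu^{n+1}=\varepsilon^2\Delta_hu^{n+1/2}+\widehat g f(\widehat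 u)-\kappa\widehat g(u^{n+1/2}-\widehat u),$$ $$\frac{s^{n+1}-s^n}{\tau}=-\widehat g\langle f(\widehat u),\delta_tu^{n+1}\rangle+\kappa\widehat g\langle u^{n+1/2}-\widehat u,\delta_tu^{n+1}\rangle.$$ Let $t_n=n\tau$, let $e_u^n=u^n-u_e(t_n)$ on the mesh, and let $e_s^n=s^n-s_e(t_n)$. Theorem (error estimate of sESAV2). There is a constant $C>0$ that depends only on $C_*$, $L$, $T$, $u_e$, $\kappa$, $\varepsilon$ and an upper bound $K$ of $|f|$ and $|f'|$ on $[-\beta,\beta]$, and not on $\tau$ and $h$, such that the following holds. There are $\tau_0,h_0>0$ such that, for all $0<\tau\le\tau_0$ and all $h=L/M\le h_0$ with $$\tau\le\Big(\frac{\kappa G^*}{2}+\frac{\varepsilon^2}{h^2}\Big)^{-1},$$ one has $$\|e_u^n\|+\|\nabla_he_u^n\|+|e_s^n|\le C(\tau^2+h^2),\qquad 0\le n\le\lfloor T/\tau\rfloor .$$ -/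

import Mathlib

open Set

noncomputable section

namespace SESAV

/-! ### Grid functions on the uniform periodic mesh of `(0,L) × (0,L)` -/

/-- Periodic grid functions on the `M × M` mesh; periodicity is built into the index set. -/
abbrev GridFn (M : ℕ) : Type := ZMod M × ZMod M → ℝ

/-- Restriction to the mesh with size `h`. For a function of period `M * h` in each variable the
representatives `0, …, M - 1` give the same values as `1, …, M`. -/
def restrict (M : ℕ) (h : ℝ) (φ : ℝ → ℝ → ℝ) : GridFn M :=
  fun p => φ ((p.1.val : ℝ) * h) ((p.2.val : ℝ) * h)

/-- Discrete inner product `h² ∑ v_{ij} w_{ij}`. -/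
def dInner {M : ℕ} [NeZero M] (h : ℝ) (v w : GridFn M) : ℝ :=
  h ^ 2 * ∑ p, v p * w p

/-- Discrete `L²` norm. -/
def dNorm {M : ℕ} [NeZero M] (h : ℝ) (v : GridFn M) : ℝ :=
  Real.sqrt (dInner h v v)

/-- Five-point discrete Laplacian. -/
def dLap {M : ℕ} (h : ℝ) (v : GridFn M) : GridFn M :=
  fun p => (v (p.1 + 1, p.2) + v (p.1 - 1, p.2) + v (p.1, p.2 + 1) + v (p.1, p.2 - 1)
    - 4 * v p) / h ^ 2

/-- First component of the discrete gradient. -/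
def dGradX {M : ℕ} (h : ℝ) (v : GridFn M) : GridFn M :=
  fun p => (v (p.1 + 1, p.2) - v p) / h

/-- Second component of the discrete gradient. -/
def dGradY {M : ℕ} (h : ℝ) (v : GridFn M) : GridFn M :=
  fun p => (v (p.1, p.2 + 1) - v p) / h

/-- Discrete `L²` norm of the discrete gradient. -/
def dGradNorm {M : ℕ} [NeZero M] (h : ℝ) (v : GridFn M) : ℝ :=
  Real.sqrt (dInner h (dGradX h v) (dGradX h v) + dInner h (dGradY h v) (dGradY h v))

/-! ### Energies -/

/-- `E₁(φ) = ∫_Ω F(φ)` on `Ω = (0,L)²`. -/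
def potentialEnergy (L : ℝ) (F : ℝ → ℝ) (φ : ℝ → ℝ → ℝ) : ℝ :=
  ∫ x in (0 : ℝ)..L, ∫ y in (0 : ℝ)..L, F (φ x y)

/-- `E(φ) = ∫_Ω (ε²/2 |∇φ|² + F(φ))` on `Ω = (0,L)²`. -/
def energy (L ε : ℝ) (F : ℝ → ℝ) (φ : ℝ → ℝ → ℝ) : ℝ :=
  ∫ x in (0 : ℝ)..L, ∫ y in (0 : ℝ)..L,
    (ε ^ 2 / 2 * ((deriv (fun x' => φ x' y) x) ^ 2 + (deriv (fun y' => φ x y') y) ^ 2)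
      + F (φ x y))

/-- `E₁ₕ(v) = ⟨F(v), 1⟩`. -/
def dPotentialEnergy {M : ℕ} [NeZero M] (h : ℝ) (F : ℝ → ℝ) (v : GridFn M) : ℝ :=
  dInner h (F ∘ v) 1

/-- `g(v,s) = exp(s) / exp(E₁ₕ(v))`. -/
def gCoef {M : ℕ} [NeZero M] (h : ℝ) (F : ℝ → ℝ) (v : GridFn M) (s : ℝ) : ℝ :=
  Real.exp s / Real.exp (dPotentialEnergy h F v)

/-- The upper bound `G^* = exp(E(φ) + 1 + C_*)` of the coefficient `g`, where `φ` is the initial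
value. -/
def gUpper (L ε Cstar : ℝ) (F : ℝ → ℝ) (φ : ℝ → ℝ → ℝ) : ℝ :=
  Real.exp (energy L ε F φ + 1 + Cstar)

/-! ### The exact solution -/

/-- `u` is `L`-periodic in each space variable and of class `C⁴` on `[0,T] × ℝ²`, all derivatives
in time and space being taken jointly and up to the end points in time. -/
structure IsSmoothPeriodic (L T : ℝ) (u : ℝ → ℝ → ℝ → ℝ) : Prop where
  smooth : ContDiffOn ℝ 4 (fun p : ℝ × ℝ × ℝ => u p.1 p.2.1 p.2.2) (Icc 0 T ×ˢ univ)
  periodic_x : ∀ t ∈ Icc 0 T, ∀ x y, u t (x + L) y = u t x y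
  periodic_y : ∀ t ∈ Icc 0 T, ∀ x y, u t x (y + L) = u t x y

/-- `u_t = ε² Δu + f(u)` for `0 < t < T`. -/
def SolvesReactionDiffusion (T ε : ℝ) (f : ℝ → ℝ) (u : ℝ → ℝ → ℝ → ℝ) : Prop :=
  ∀ t ∈ Ioo 0 T, ∀ x y,
    deriv (fun t' => u t' x y) t
      = ε ^ 2 * (iteratedDeriv 2 (fun x' => u t x' y) x + iteratedDeriv 2 (fun y' => u t x y') y)
        + f (u t x y)

/-! ### The second-order stabilized exponential-SAV scheme -/

/-- `(uh n, sh n)` is the predictor with index `n + 1/2`, obtained by one step of length `τ/2` of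
the first-order scheme. -/
structure IsSESAV2 {M : ℕ} [NeZero M] (h τ ε κ : ℝ) (f F : ℝ → ℝ) (u₀ : GridFn M)
    (u : ℕ → GridFn M) (s : ℕ → ℝ) (uh : ℕ → GridFn M) (sh : ℕ → ℝ) : Prop where
  init_u : u 0 = u₀
  init_s : s 0 = dPotentialEnergy h F (u 0)
  predictor_u : ∀ n,
    (τ / 2)⁻¹ • (uh n - u n)
      = ε ^ 2 • dLap h (uh n) + gCoef h F (u n) (s n) • (f ∘ u n)
        - (κ * gCoef h F (u n) (s n)) • (uh n - u n)
  predictor_s : ∀ n,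
    sh n - s n = - gCoef h F (u n) (s n) * dInner h (f ∘ u n) (uh n - u n)
  corrector_u : ∀ n,
    τ⁻¹ • (u (n + 1) - u n)
      = ε ^ 2 • dLap h ((1 / 2 : ℝ) • (u (n + 1) + u n))
        + gCoef h F (uh n) (sh n) • (f ∘ uh n)
        - (κ * gCoef h F (uh n) (sh n)) • ((1 / 2 : ℝ) • (u (n + 1) + u n) - uh n)
  corrector_s : ∀ n,
    (s (n + 1) - s n) / τ
      = - gCoef h F (uh n) (sh n) * dInner h (f ∘ uh n) (τ⁻¹ • (u (n + 1) - u n))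
        + κ * gCoef h F (uh n) (sh n)
          * dInner h ((1 / 2 : ℝ) • (u (n + 1) + u n) - uh n) (τ⁻¹ • (u (n + 1) - u n))

end SESAV

end

/-!
Second-order convergence of the scheme sESAV2.

The scheme is compared with the mesh values `U(t)` of the exact solution and with
`E₁ₕ(U(t))`, rather than with `E₁(u_e(t))`: then the coefficient `g(U, E₁ₕ(U))` is exactly `1`, the
initial errors vanish, and the quadrature error `E₁ₕ(U(t)) - E₁(u_e(t)) = O(h²)`
(`abs_dPotentialEnergy_restrict_sub_le`) enters only at the end.

*Consistency* (`isConsistent_restrict`). All equations are expanded about interior points in time,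
where the differential equation holds. The nonlinearity is only `C¹`, but along the solution
`f(u_e) = u_t - ε² Δu` is of class `C²`, and this is what makes the equation for the auxiliary
variable second-order accurate (`abs_potential_truncation_le`). Besides `ε`, the constants involve
only bounds for the derivatives of `u_e`, for `f` and for the Lipschitz constant of `f`.

*Stability*. Let `b = ‖e_u‖ + |e_s| + τ² + h²`, with `e_s = s - E₁ₕ(U)`. Testing the
predictor equation with the error of the predictor shows that this error is `O(b)`
(`exists_predictor_const`). Testing the corrector equation with the average of the
errors at both ends of the step bounds the growth of `‖e_u‖`, and testing it
with their difference quotient `D` bounds the growth of `‖∇ₕ e_u‖²` while leaving a term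
`τ ‖D‖²` (`exists_corrector_const`). That term absorbs the contribution of `D` to the equation of
the auxiliary variable, so that `‖e_u‖² + ε² ‖∇ₕ e_u‖² + e_s²` satisfies a discrete Gronwall
inequality (`sq_step_le`).

*Range of the numerical solution*. The stability estimates need the numerical solution to stay in an
interval `[-β - δ, β + δ] ⊆ J`. The exact solution stays in `[-β, β]` by the maximum principle
(`SolvesReactionDiffusion.maximum_bound`). The step restriction gives `τ ≤ h² / ε²`, hence
`τ² + h² = O(h²)`, and the inverse inequality `‖e‖_∞ ≤ ‖e‖ / h` turns the error bound of the
previous step into `‖e_u‖_∞ = O(h)`, which is less than `δ` for small `h`. No maximum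
bound principle for the scheme itself is used.
-/

namespace SESAV

/-! ### Smooth periodic functions on the space-time strip -/

/-- The closed space-time strip `[0,T] × ℝ²`. -/
def strip (T : ℝ) : Set (ℝ × ℝ × ℝ) := Icc 0 T ×ˢ univ

theorem mem_strip {T t x y : ℝ} : (t, x, y) ∈ strip T ↔ t ∈ Icc 0 T := by
  simp [strip]

theorem uniqueDiffOn_strip {T : ℝ} (hT : 0 < T) : UniqueDiffOn ℝ (strip T) :=
  (uniqueDiffOn_Icc hT).prod uniqueDiffOn_univ

/-- Functions of class `Cⁿ` on the strip, up to the end points in time, that are `L`-periodic in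
both space variables. -/
structure IsPeriodicCn (L T : ℝ) (n : ℕ) (w : ℝ × ℝ × ℝ → ℝ) : Prop where
  smooth : ContDiffOn ℝ n w (strip T)
  periodic_x : ∀ p ∈ strip T, w (p + (0, L, 0)) = w p
  periodic_y : ∀ p ∈ strip T, w (p + (0, 0, L)) = w p

/-- Directional derivative relative to the strip. It is one-sided in time at `t = 0` and
`t = T`. -/
noncomputable def stripDeriv (T : ℝ) (e : ℝ × ℝ × ℝ) (w : ℝ × ℝ × ℝ → ℝ) : ℝ × ℝ × ℝ → ℝ :=
  fun p => fderivWithin ℝ w (strip T) p e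

open scoped Pointwise in
theorem stripDeriv_add {T : ℝ} {w : ℝ × ℝ × ℝ → ℝ} {a : ℝ × ℝ} (e : ℝ × ℝ × ℝ)
    (hw : ∀ p ∈ strip T, w (p + (0, a)) = w p) {p : ℝ × ℝ × ℝ} (hp : p ∈ strip T) :
    stripDeriv T e w (p + (0, a)) = stripDeriv T e w p := by
  have hset : ((0, a) : ℝ × ℝ × ℝ) +ᵥ strip T = strip T := by
    ext q
    rw [Set.mem_vadd_set_iff_neg_vadd_mem]
    simp [strip]
  have h1 := fderivWithin_comp_add_right (𝕜 := ℝ) (f := w) (s := strip T) (x := p) ((0, a))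
  rw [hset] at h1
  unfold stripDeriv
  rw [← h1]
  congr 1
  exact fderivWithin_congr hw (hw p hp)

theorem IsPeriodicCn.stripDeriv {L T : ℝ} (hT : 0 < T) {n : ℕ} {w : ℝ × ℝ × ℝ → ℝ}
    (hw : IsPeriodicCn L T (n + 1) w) (e : ℝ × ℝ × ℝ) :
    IsPeriodicCn L T n (stripDeriv T e w) where
  smooth := by
    have := hw.smooth.fderivWithin (m := n) (uniqueDiffOn_strip hT) (by norm_cast)
    exact this.clm_apply contDiffOn_const
  periodic_x := fun p hp => stripDeriv_add e hw.periodic_x hp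
  periodic_y := fun p hp => stripDeriv_add e hw.periodic_y hp

theorem IsPeriodicCn.exists_bound {L T : ℝ} (hL : 0 < L) {n : ℕ} {w : ℝ × ℝ × ℝ → ℝ}
    (hw : IsPeriodicCn L T n w) : ∃ B : ℝ, ∀ p ∈ strip T, |w p| ≤ B := by
  have hc : ContinuousOn w (Icc 0 T ×ˢ (Icc 0 L ×ˢ Icc 0 L)) :=
    hw.smooth.continuousOn.mono (Set.prod_mono le_rfl (subset_univ _))
  obtain ⟨B, hB⟩ :=
    (isCompact_Icc.prod (isCompact_Icc.prod isCompact_Icc)).exists_bound_of_continuousOn hc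
  refine ⟨B, ?_⟩
  rintro ⟨t, x, y⟩ hp
  have ht := mem_strip.1 hp
  have hx : ∀ y, Function.Periodic (fun x => w (t, x, y)) L := fun y x => by
    simpa using hw.periodic_x (t, x, y) (mem_strip.2 ht)
  have hy : ∀ x, Function.Periodic (fun y => w (t, x, y)) L := fun x y => by
    simpa using hw.periodic_y (t, x, y) (mem_strip.2 ht)
  obtain ⟨x', hx', h1⟩ := (hx y).exists_mem_Ico₀ hL x
  obtain ⟨y', hy', h2⟩ := (hy x').exists_mem_Ico₀ hL y
  rw [h1, h2]
  exact hB (t, x', y') ⟨ht, Ico_subset_Icc_self hx', Ico_subset_Icc_self hy'⟩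

theorem IsPeriodicCn.hasFDerivWithinAt {L T : ℝ} {n : ℕ} (hn : n ≠ 0) {w : ℝ × ℝ × ℝ → ℝ}
    (hw : IsPeriodicCn L T n w) {p : ℝ × ℝ × ℝ} (hp : p ∈ strip T) :
    HasFDerivWithinAt w (fderivWithin ℝ w (strip T) p) (strip T) p :=
  (hw.smooth.differentiableOn (by exact_mod_cast hn) p hp).hasFDerivWithinAt

theorem IsPeriodicCn.hasDerivAt_time {L T : ℝ} {n : ℕ} (hn : n ≠ 0) {w : ℝ × ℝ × ℝ → ℝ}
    (hw : IsPeriodicCn L T n w) {t : ℝ} (ht : t ∈ Ioo 0 T) (x y : ℝ) :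
    HasDerivAt (fun t' => w (t', x, y)) (SESAV.stripDeriv T (1, 0, 0) w (t, x, y)) t := by
  have h1 := hw.hasFDerivWithinAt hn (mem_strip.2 (Ioo_subset_Icc_self ht) : (t, x, y) ∈ strip T)
  have h2 : HasDerivWithinAt (fun t' : ℝ => ((t', x, y) : ℝ × ℝ × ℝ)) (1, 0, 0) (Icc 0 T) t :=
    ((hasDerivAt_id t).prodMk ((hasDerivAt_const t (x, y)))).hasDerivWithinAt
  exact (h1.comp_hasDerivWithinAt t h2 (fun s hs => mem_strip.2 hs)).hasDerivAt
    (Icc_mem_nhds ht.1 ht.2)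

theorem IsPeriodicCn.hasDerivAt_x {L T : ℝ} {n : ℕ} (hn : n ≠ 0) {w : ℝ × ℝ × ℝ → ℝ}
    (hw : IsPeriodicCn L T n w) {t : ℝ} (ht : t ∈ Icc 0 T) (x y : ℝ) :
    HasDerivAt (fun x' => w (t, x', y)) (SESAV.stripDeriv T (0, 1, 0) w (t, x, y)) x := by
  have h1 := hw.hasFDerivWithinAt hn (mem_strip.2 ht : (t, x, y) ∈ strip T)
  have h2 : HasDerivAt (fun x' : ℝ => ((t, x', y) : ℝ × ℝ × ℝ)) (0, 1, 0) x :=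
    (hasDerivAt_const x t).prodMk ((hasDerivAt_id x).prodMk (hasDerivAt_const x y))
  exact h1.comp_hasDerivAt x h2 (.of_forall fun s => mem_strip.2 ht)

theorem IsPeriodicCn.hasDerivAt_y {L T : ℝ} {n : ℕ} (hn : n ≠ 0) {w : ℝ × ℝ × ℝ → ℝ}
    (hw : IsPeriodicCn L T n w) {t : ℝ} (ht : t ∈ Icc 0 T) (x y : ℝ) :
    HasDerivAt (fun y' => w (t, x, y')) (SESAV.stripDeriv T (0, 0, 1) w (t, x, y)) y := by
  have h1 := hw.hasFDerivWithinAt hn (mem_strip.2 ht : (t, x, y) ∈ strip T)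
  have h2 : HasDerivAt (fun y' : ℝ => ((t, x, y') : ℝ × ℝ × ℝ)) (0, 0, 1) y :=
    (hasDerivAt_const y t).prodMk ((hasDerivAt_const y x).prodMk (hasDerivAt_id y))
  exact h1.comp_hasDerivAt y h2 (.of_forall fun s => mem_strip.2 ht)

theorem IsPeriodicCn.continuousOn_time {L T : ℝ} {n : ℕ} {w : ℝ × ℝ × ℝ → ℝ}
    (hw : IsPeriodicCn L T n w) (x y : ℝ) : ContinuousOn (fun t => w (t, x, y)) (Icc 0 T) :=
  hw.smooth.continuousOn.comp (by fun_prop) (fun t ht => mem_strip.2 ht)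

theorem IsPeriodicCn.continuous_space {L T : ℝ} {n : ℕ} {w : ℝ × ℝ × ℝ → ℝ}
    (hw : IsPeriodicCn L T n w) {t : ℝ} (ht : t ∈ Icc 0 T) :
    Continuous (fun q : ℝ × ℝ => w (t, q)) := by
  rw [← continuousOn_univ]
  exact hw.smooth.continuousOn.comp (by fun_prop) (fun q _ => mem_strip.2 ht)

/-- The coordinate directions of space-time: `0` is time, `1` and `2` are the space variables. -/
def coordDir : Fin 3 → ℝ × ℝ × ℝ := ![(1, 0, 0), (0, 1, 0), (0, 0, 1)]

/-- Iterated partial derivative on the strip; the directions in the list are applied from right to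
left. -/
noncomputable def iterPartial (T : ℝ) (w : ℝ × ℝ × ℝ → ℝ) : List (Fin 3) → ℝ × ℝ × ℝ → ℝ
  | [] => w
  | i :: l => stripDeriv T (coordDir i) (iterPartial T w l)

theorem IsPeriodicCn.iterPartial {L T : ℝ} (hT : 0 < T) {w : ℝ × ℝ × ℝ → ℝ} (l : List (Fin 3)) :
    ∀ {n : ℕ}, IsPeriodicCn L T (n + l.length) w → IsPeriodicCn L T n (iterPartial T w l) := by
  induction l with
  | nil => intro n hw; exact hw
  | cons i l ih =>
    intro n hw
    refine (ih (n := n + 1) ?_).stripDeriv hT _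
    rwa [List.length_cons, ← Nat.add_assoc, Nat.add_right_comm] at hw

theorem IsPeriodicCn.exists_iterPartial_bound {L T : ℝ} (hL : 0 < L) (hT : 0 < T) {n : ℕ}
    {w : ℝ × ℝ × ℝ → ℝ} (hw : IsPeriodicCn L T n w) :
    ∃ B : ℝ, 0 ≤ B ∧ ∀ l : List (Fin 3), l.length ≤ n → ∀ p ∈ strip T,
      |SESAV.iterPartial T w l p| ≤ B := by
  have h1 : ∀ l : List (Fin 3), ∃ B : ℝ, l.length ≤ n → ∀ p ∈ strip T,
      |SESAV.iterPartial T w l p| ≤ B := by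
    intro l
    by_cases hl : l.length ≤ n
    · obtain ⟨k, rfl⟩ := Nat.exists_eq_add_of_le' hl
      obtain ⟨B, hB⟩ := (hw.iterPartial hT l).exists_bound hL
      exact ⟨B, fun _ => hB⟩
    · exact ⟨0, fun h => absurd h hl⟩
  choose B hB using h1
  obtain ⟨C, hC⟩ := ((List.finite_length_le (Fin 3) n).image B).bddAbove
  refine ⟨max C 0, le_max_right _ _, fun l hl p hp => (hB l hl p hp).trans ?_⟩
  exact (hC ⟨l, hl, rfl⟩).trans (le_max_left _ _)

theorem IsSmoothPeriodic.isPeriodicCn {L T : ℝ} {u : ℝ → ℝ → ℝ → ℝ} (hu : IsSmoothPeriodic L T u) :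
    IsPeriodicCn L T 4 (fun p => u p.1 p.2.1 p.2.2) where
  smooth := by exact_mod_cast hu.smooth
  periodic_x := by
    rintro ⟨t, x, y⟩ hp
    simpa using hu.periodic_x t (mem_strip.1 hp) x y
  periodic_y := by
    rintro ⟨t, x, y⟩ hp
    simpa using hu.periodic_y t (mem_strip.1 hp) x y

/-! ### Difference quotients in one variable -/

theorem abs_sub_le_of_hasDerivAt {q q' : ℝ → ℝ} {a b C : ℝ} (hab : a ≤ b)
    (hc : ContinuousOn q (Icc a b)) (hd : ∀ r ∈ Ioo a b, HasDerivAt q (q' r) r)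
    (hb : ∀ r ∈ Ioo a b, |q' r| ≤ C) : |q b - q a| ≤ C * (b - a) := by
  rcases hab.eq_or_lt with rfl | hlt
  · simp
  obtain ⟨c, hcm, hce⟩ := exists_hasDerivAt_eq_slope q q' hlt hc hd
  have hpos : 0 < b - a := sub_pos.2 hlt
  rw [eq_div_iff hpos.ne'] at hce
  rw [← hce, abs_mul, abs_of_pos hpos]
  exact mul_le_mul_of_nonneg_right (hb c hcm) hpos.le

theorem abs_le_of_hasDerivAt_zero {q q' : ℝ → ℝ} {s C : ℝ} (hs : 0 ≤ s) (h0 : q 0 = 0)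
    (hc : ContinuousOn q (Icc 0 s)) (hd : ∀ r ∈ Ioo 0 s, HasDerivAt q (q' r) r)
    (hb : ∀ r ∈ Ioo 0 s, |q' r| ≤ C) : |q s| ≤ C * s := by
  simpa [h0] using abs_sub_le_of_hasDerivAt hs hc hd hb

theorem continuousOn_comp_add {w : ℝ → ℝ} {m s : ℝ} (hc : ContinuousOn w (Icc (m - s) (m + s))) :
    ContinuousOn (fun r => w (m + r)) (Icc 0 s) :=
  hc.comp (by fun_prop) fun r hr => ⟨by linarith [hr.1, hr.2], by linarith [hr.2]⟩

theorem continuousOn_comp_sub {w : ℝ → ℝ} {m s : ℝ} (hc : ContinuousOn w (Icc (m - s) (m + s))) :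
    ContinuousOn (fun r => w (m - r)) (Icc 0 s) :=
  hc.comp (by fun_prop) fun r hr => ⟨by linarith [hr.2], by linarith [hr.1, hr.2]⟩

theorem Icc_sub_add_subset_Ioo {m r s : ℝ} (hr : r < s) :
    Icc (m - r) (m + r) ⊆ Ioo (m - s) (m + s) :=
  fun z hz => ⟨by linarith [hz.1], by linarith [hz.2]⟩

section Differences

variable {w w₁ w₂ w₃ w₄ : ℝ → ℝ} {m s B : ℝ}

theorem abs_central_sub_le (hs : 0 ≤ s) (hc : ContinuousOn w (Icc (m - s) (m + s)))
    (h1 : ∀ r ∈ Ioo (m - s) (m + s), HasDerivAt w (w₁ r) r)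
    (hb : ∀ r ∈ Ioo (m - s) (m + s), |w₁ r| ≤ B) :
    |w (m + s) - w (m - s)| ≤ 2 * B * s := by
  have := abs_sub_le_of_hasDerivAt (by linarith) hc h1 hb
  linarith

theorem abs_second_diff_le (hs : 0 ≤ s) (hc : ContinuousOn w (Icc (m - s) (m + s)))
    (h1 : ∀ r ∈ Ioo (m - s) (m + s), HasDerivAt w (w₁ r) r)
    (h2 : ∀ r ∈ Ioo (m - s) (m + s), HasDerivAt w₁ (w₂ r) r)
    (hb : ∀ r ∈ Ioo (m - s) (m + s), |w₂ r| ≤ B) :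
    |w (m + s) + w (m - s) - 2 * w m| ≤ 2 * B * s ^ 2 := by
  have key := abs_le_of_hasDerivAt_zero (q := fun r => w (m + r) + w (m - r) - 2 * w m)
    (q' := fun r => w₁ (m + r) - w₁ (m - r)) (C := 2 * B * s) hs (by simp; ring)
    (((continuousOn_comp_add hc).add (continuousOn_comp_sub hc)).sub continuousOn_const) ?_ ?_
  · calc _ ≤ _ := key
      _ = _ := by ring
  · intro r hr
    have a1 := (h1 (m + r) ⟨by linarith [hr.1, hr.2], by linarith [hr.2]⟩).comp_const_add m r
    have a2 := (h1 (m - r) ⟨by linarith [hr.2], by linarith [hr.1, hr.2]⟩).comp_const_sub m r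
    exact ((a1.add a2).sub_const (2 * w m)).congr_deriv (by ring)
  · intro r hr
    have hsub := Icc_sub_add_subset_Ioo (m := m) hr.2
    have a := abs_central_sub_le hr.1.le
      (fun z hz => (h2 z (hsub hz)).continuousAt.continuousWithinAt)
      (fun z hz => h2 z (hsub (Ioo_subset_Icc_self hz)))
      (fun z hz => hb z (hsub (Ioo_subset_Icc_self hz)))
    have hB : 0 ≤ B := (abs_nonneg _).trans
      (hb m ⟨by linarith [hr.1, hr.2], by linarith [hr.1, hr.2]⟩)
    refine a.trans ?_
    have := hr.2.le
    gcongr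

theorem abs_central_sub_deriv_le (hs : 0 ≤ s) (hc : ContinuousOn w (Icc (m - s) (m + s)))
    (h1 : ∀ r ∈ Ioo (m - s) (m + s), HasDerivAt w (w₁ r) r)
    (h2 : ∀ r ∈ Ioo (m - s) (m + s), HasDerivAt w₁ (w₂ r) r)
    (h3 : ∀ r ∈ Ioo (m - s) (m + s), HasDerivAt w₂ (w₃ r) r)
    (hb : ∀ r ∈ Ioo (m - s) (m + s), |w₃ r| ≤ B) :
    |w (m + s) - w (m - s) - 2 * s * w₁ m| ≤ 2 * B * s ^ 3 := by
  have key := abs_le_of_hasDerivAt_zero (q := fun r => w (m + r) - w (m - r) - 2 * r * w₁ m)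
    (q' := fun r => w₁ (m + r) + w₁ (m - r) - 2 * w₁ m) (C := 2 * B * s ^ 2) hs (by simp)
    (((continuousOn_comp_add hc).sub (continuousOn_comp_sub hc)).sub (by fun_prop)) ?_ ?_
  · calc _ ≤ _ := key
      _ = _ := by ring
  · intro r hr
    have a1 := (h1 (m + r) ⟨by linarith [hr.1, hr.2], by linarith [hr.2]⟩).comp_const_add m r
    have a2 := (h1 (m - r) ⟨by linarith [hr.2], by linarith [hr.1, hr.2]⟩).comp_const_sub m r
    have a3 := ((hasDerivAt_id r).const_mul 2).mul_const (w₁ m)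
    exact ((a1.sub a2).sub a3).congr_deriv (by ring)
  · intro r hr
    have hsub := Icc_sub_add_subset_Ioo (m := m) hr.2
    have a := abs_second_diff_le hr.1.le
      (fun z hz => (h2 z (hsub hz)).continuousAt.continuousWithinAt)
      (fun z hz => h2 z (hsub (Ioo_subset_Icc_self hz)))
      (fun z hz => h3 z (hsub (Ioo_subset_Icc_self hz)))
      (fun z hz => hb z (hsub (Ioo_subset_Icc_self hz)))
    have hB : 0 ≤ B := (abs_nonneg _).trans
      (hb m ⟨by linarith [hr.1, hr.2], by linarith [hr.1, hr.2]⟩)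
    refine a.trans ?_
    have := hr.2.le
    have := hr.1.le
    gcongr

theorem abs_second_diff_sub_deriv_le (hs : 0 ≤ s) (hc : ContinuousOn w (Icc (m - s) (m + s)))
    (h1 : ∀ r ∈ Ioo (m - s) (m + s), HasDerivAt w (w₁ r) r)
    (h2 : ∀ r ∈ Ioo (m - s) (m + s), HasDerivAt w₁ (w₂ r) r)
    (h3 : ∀ r ∈ Ioo (m - s) (m + s), HasDerivAt w₂ (w₃ r) r)
    (h4 : ∀ r ∈ Ioo (m - s) (m + s), HasDerivAt w₃ (w₄ r) r)
    (hb : ∀ r ∈ Ioo (m - s) (m + s), |w₄ r| ≤ B) :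
    |w (m + s) + w (m - s) - 2 * w m - s ^ 2 * w₂ m| ≤ 2 * B * s ^ 4 := by
  have key := abs_le_of_hasDerivAt_zero
    (q := fun r => w (m + r) + w (m - r) - 2 * w m - r ^ 2 * w₂ m)
    (q' := fun r => w₁ (m + r) - w₁ (m - r) - 2 * r * w₂ m) (C := 2 * B * s ^ 3) hs (by simp; ring)
    ((((continuousOn_comp_add hc).add (continuousOn_comp_sub hc)).sub continuousOn_const).sub
      (by fun_prop)) ?_ ?_
  · calc _ ≤ _ := key
      _ = _ := by ring
  · intro r hr
    have a1 := (h1 (m + r) ⟨by linarith [hr.1, hr.2], by linarith [hr.2]⟩).comp_const_add m r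
    have a2 := (h1 (m - r) ⟨by linarith [hr.2], by linarith [hr.1, hr.2]⟩).comp_const_sub m r
    have a3 := (hasDerivAt_pow 2 r).mul_const (w₂ m)
    exact (((a1.add a2).sub_const (2 * w m)).sub a3).congr_deriv (by push_cast; ring)
  · intro r hr
    have hsub := Icc_sub_add_subset_Ioo (m := m) hr.2
    have a := abs_central_sub_deriv_le hr.1.le
      (fun z hz => (h2 z (hsub hz)).continuousAt.continuousWithinAt)
      (fun z hz => h2 z (hsub (Ioo_subset_Icc_self hz)))
      (fun z hz => h3 z (hsub (Ioo_subset_Icc_self hz)))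
      (fun z hz => h4 z (hsub (Ioo_subset_Icc_self hz)))
      (fun z hz => hb z (hsub (Ioo_subset_Icc_self hz)))
    have hB : 0 ≤ B := (abs_nonneg _).trans
      (hb m ⟨by linarith [hr.1, hr.2], by linarith [hr.1, hr.2]⟩)
    refine a.trans ?_
    have := hr.2.le
    have := hr.1.le
    gcongr

/-- Midpoint rule for `∫ φ dw`, where `P` is a primitive of `-φ w'`: the first-order terms of `φ`
and `w'` at the midpoint cancel by symmetry, so that only second-order differences of `φ` and
products of first-order differences are left. -/
theorem abs_midpoint_stieltjes_le {P φ φ₁ φ₂ : ℝ → ℝ} (hs : 0 ≤ s)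
    (hP : ContinuousOn P (Icc (m - s) (m + s))) (hc : ContinuousOn w (Icc (m - s) (m + s)))
    (h1 : ∀ r ∈ Ioo (m - s) (m + s), HasDerivAt w (w₁ r) r)
    (h2 : ∀ r ∈ Ioo (m - s) (m + s), HasDerivAt w₁ (w₂ r) r)
    (hP1 : ∀ r ∈ Ioo (m - s) (m + s), HasDerivAt P (-φ r * w₁ r) r)
    (hφ1 : ∀ r ∈ Ioo (m - s) (m + s), HasDerivAt φ (φ₁ r) r)
    (hφ2 : ∀ r ∈ Ioo (m - s) (m + s), HasDerivAt φ₁ (φ₂ r) r)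
    (b1 : ∀ r ∈ Ioo (m - s) (m + s), |w₁ r| ≤ B)
    (b2 : ∀ r ∈ Ioo (m - s) (m + s), |w₂ r| ≤ B)
    (c1 : ∀ r ∈ Ioo (m - s) (m + s), |φ₁ r| ≤ B)
    (c2 : ∀ r ∈ Ioo (m - s) (m + s), |φ₂ r| ≤ B) :
    |P (m + s) - P (m - s) + φ m * (w (m + s) - w (m - s))| ≤ 4 * B ^ 2 * s ^ 3 := by
  have key := abs_le_of_hasDerivAt_zero
    (q := fun r => P (m + r) - P (m - r) + φ m * (w (m + r) - w (m - r)))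
    (q' := fun r => -φ (m + r) * w₁ (m + r) - φ (m - r) * w₁ (m - r)
      + φ m * (w₁ (m + r) + w₁ (m - r))) (C := 4 * B ^ 2 * s ^ 2) hs (by simp)
    (((continuousOn_comp_add hP).sub (continuousOn_comp_sub hP)).add
      (continuousOn_const.mul ((continuousOn_comp_add hc).sub (continuousOn_comp_sub hc)))) ?_ ?_
  · calc _ ≤ _ := key
      _ = _ := by ring
  · intro r hr
    have m1 : m + r ∈ Ioo (m - s) (m + s) := ⟨by linarith [hr.1, hr.2], by linarith [hr.2]⟩
    have m2 : m - r ∈ Ioo (m - s) (m + s) := ⟨by linarith [hr.2], by linarith [hr.1, hr.2]⟩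
    have a1 := (h1 _ m1).comp_const_add m r
    have a2 := (h1 _ m2).comp_const_sub m r
    have a3 := (hP1 _ m1).comp_const_add m r
    have a4 := (hP1 _ m2).comp_const_sub m r
    exact ((a3.sub a4).add ((a1.sub a2).const_mul (φ m))).congr_deriv (by ring)
  · intro r hr
    have hsub := Icc_sub_add_subset_Ioo (m := m) hr.2
    have hsub' : Ioo (m - r) (m + r) ⊆ Ioo (m - s) (m + s) := Ioo_subset_Icc_self.trans hsub
    have hmm : m ∈ Ioo (m - s) (m + s) := ⟨by linarith [hr.1, hr.2], by linarith [hr.1, hr.2]⟩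
    have m1 : m + r ∈ Ioo (m - s) (m + s) := ⟨by linarith [hr.1, hr.2], by linarith [hr.2]⟩
    have hB : 0 ≤ B := (abs_nonneg _).trans (b1 m hmm)
    have d1 := abs_second_diff_le hr.1.le
      (fun z hz => (hφ1 z (hsub hz)).continuousAt.continuousWithinAt)
      (fun z hz => hφ1 z (hsub' hz)) (fun z hz => hφ2 z (hsub' hz)) (fun z hz => c2 z (hsub' hz))
    have d2 := abs_central_sub_le hr.1.le
      (fun z hz => (h2 z (hsub hz)).continuousAt.continuousWithinAt)
      (fun z hz => h2 z (hsub' hz)) (fun z hz => b2 z (hsub' hz))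
    have d3 := abs_sub_le_of_hasDerivAt (a := m - r) (b := m) (by linarith [hr.1])
      (fun z hz => (hφ1 z (hsub ⟨hz.1, by linarith [hz.2, hr.1]⟩)).continuousAt.continuousWithinAt)
      (fun z hz => hφ1 z (hsub ⟨hz.1.le, by linarith [hz.2, hr.1]⟩))
      (fun z hz => c1 z (hsub ⟨hz.1.le, by linarith [hz.2, hr.1]⟩))
    rw [sub_sub_cancel] at d3
    have hr0 := hr.1.le
    have e1 : -φ (m + r) * w₁ (m + r) - φ (m - r) * w₁ (m - r) + φ m * (w₁ (m + r) + w₁ (m - r))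
        = -((φ (m + r) + φ (m - r) - 2 * φ m) * w₁ (m + r))
          - (φ m - φ (m - r)) * (w₁ (m + r) - w₁ (m - r)) + 0 := by ring
    have e2 : |(φ (m + r) + φ (m - r) - 2 * φ m) * w₁ (m + r)| ≤ 2 * B * r ^ 2 * B := by
      rw [abs_mul]
      exact mul_le_mul d1 (b1 _ m1) (abs_nonneg _) (by positivity)
    have e3 : |(φ m - φ (m - r)) * (w₁ (m + r) - w₁ (m - r))| ≤ B * r * (2 * B * r) := by
      rw [abs_mul]
      exact mul_le_mul d3 d2 (abs_nonneg _) (by positivity)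
    rw [e1, add_zero]
    calc _ ≤ 2 * B * r ^ 2 * B + B * r * (2 * B * r) := by
          refine (abs_sub _ _).trans ?_
          rw [abs_neg]
          exact add_le_add e2 e3
      _ = 4 * B ^ 2 * r ^ 2 := by ring
      _ ≤ _ := by
          have := hr.2.le
          gcongr

end Differences

/-! ### The nonlinearity near `[-β, β]` -/

/-- `f` is bounded by `K` and `K`-Lipschitz on `[-a, a]`, and `F` is a primitive of `-f` there. -/
structure IsTameOn (K a : ℝ) (f F : ℝ → ℝ) : Prop where
  bound : ∀ ξ ∈ Icc (-a) a, |f ξ| ≤ K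
  lipschitz : ∀ ξ ∈ Icc (-a) a, ∀ η ∈ Icc (-a) a, |f ξ - f η| ≤ K * |ξ - η|
  hasDerivAt : ∀ ξ ∈ Icc (-a) a, HasDerivAt F (-f ξ) ξ

namespace IsTameOn

variable {K a : ℝ} {f F : ℝ → ℝ}

theorem abs_primitive_sub_le (hf : IsTameOn K a f F) {ξ η : ℝ} (hξ : ξ ∈ Icc (-a) a)
    (hη : η ∈ Icc (-a) a) : |F ξ - F η| ≤ K * |ξ - η| := by
  have := (convex_Icc (-a) a).norm_image_sub_le_of_norm_hasDerivWithin_le (f := F)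
    (f' := fun ξ => -f ξ) (C := K) (fun z hz => (hf.hasDerivAt z hz).hasDerivWithinAt)
    (fun z hz => by simpa using hf.bound z hz) hη hξ
  simpa using this

theorem nonneg (hf : IsTameOn K a f F) (ha : 0 ≤ a) : 0 ≤ K :=
  (abs_nonneg _).trans (hf.bound 0 ⟨by linarith, ha⟩)

theorem abs_primitive_sub_add_le (hf : IsTameOn K a f F) {ξ η : ℝ} (hξ : ξ ∈ Icc (-a) a)
    (hη : η ∈ Icc (-a) a) : |F η - F ξ + f ξ * (η - ξ)| ≤ K * |η - ξ| ^ 2 := by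
  have hsub : uIcc ξ η ⊆ Icc (-a) a := (ordConnected_Icc).uIcc_subset hξ hη
  have := (convex_uIcc ξ η).norm_image_sub_le_of_norm_hasDerivWithin_le
    (f := fun z => F z + f ξ * z) (f' := fun z => -f z + f ξ * 1) (C := K * |η - ξ|)
    (fun z hz => ((hf.hasDerivAt z (hsub hz)).add
      ((hasDerivAt_id z).const_mul (f ξ))).hasDerivWithinAt)
    (fun z hz => by
      rw [Real.norm_eq_abs, show -f z + f ξ * 1 = f ξ - f z by ring]
      refine (hf.lipschitz ξ hξ z (hsub hz)).trans ?_
      have hK : 0 ≤ K := (abs_nonneg _).trans (hf.bound ξ hξ)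
      have : |ξ - z| ≤ |η - ξ| := by
        rw [abs_sub_comm]
        exact abs_sub_left_of_mem_uIcc hz
      gcongr) left_mem_uIcc right_mem_uIcc
  simp only [Real.norm_eq_abs] at this
  rw [show F η + f ξ * η - (F ξ + f ξ * ξ) = F η - F ξ + f ξ * (η - ξ) by ring] at this
  calc _ ≤ _ := this
    _ = _ := by ring

end IsTameOn

/-- The bounds of `f` and `f'` on `[-β, β]` persist, with slightly larger constants, on a
neighbourhood. The numerical solution is only known to stay in such a neighbourhood. -/
theorem exists_isTameOn {β K : ℝ} {f F : ℝ → ℝ} {J : Set ℝ} (hβ : 0 < β) (hJ : IsOpen J)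
    (hβJ : Icc (-β) β ⊆ J) (hf : ContDiffOn ℝ 1 f J) (hF : ∀ ξ ∈ J, HasDerivAt F (-f ξ) ξ)
    (hK : ∀ ξ ∈ Icc (-β) β, |f ξ| ≤ K ∧ |deriv f ξ| ≤ K) :
    ∃ δ : ℝ, 0 < δ ∧ IsTameOn (K + 1) (β + δ) f F := by
  have c1 : ContinuousOn (fun ξ => |f ξ|) J := hf.continuousOn.abs
  have c2 : ContinuousOn (fun ξ => |deriv f ξ|) J :=
    (hf.continuousOn_deriv_of_isOpen hJ le_rfl).abs
  have o1 := c1.isOpen_inter_preimage hJ (isOpen_Iio (a := K + 1))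
  have o2 := c2.isOpen_inter_preimage hJ (isOpen_Iio (a := K + 1))
  obtain ⟨δ, hδ, hsub⟩ := isCompact_Icc.exists_cthickening_subset_open (o1.inter o2)
    (s := Icc (-β) β) (fun ξ hξ => ⟨⟨hβJ hξ, by
      have := (hK ξ hξ).1; simp only [mem_preimage, mem_Iio]; linarith⟩, ⟨hβJ hξ, by
      have := (hK ξ hξ).2; simp only [mem_preimage, mem_Iio]; linarith⟩⟩)
  have hI : Icc (-(β + δ)) (β + δ) ⊆ Metric.cthickening δ (Icc (-β) β) := by
    intro ξ hξ
    refine Metric.mem_cthickening_of_dist_le ξ (max (-β) (min β ξ)) δ _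
      ⟨le_max_left _ _, max_le (by linarith) (min_le_left _ _)⟩ ?_
    rw [Real.dist_eq, abs_le]
    rcases le_total β ξ with h | h
    · rw [min_eq_left h, max_eq_right (by linarith)]
      constructor <;> linarith [hξ.2]
    · rw [min_eq_right h]
      rcases le_total (-β) ξ with h' | h'
      · rw [max_eq_right h']; constructor <;> linarith
      · rw [max_eq_left h']; constructor <;> linarith [hξ.1]
  refine ⟨δ, hδ, ?_, ?_, ?_⟩
  · intro ξ hξ
    exact (hsub (hI hξ)).1.2.le
  · intro ξ hξ η hη
    have := (convex_Icc (-(β + δ)) (β + δ)).norm_image_sub_le_of_norm_hasDerivWithin_le (f := f)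
      (f' := deriv f) (C := K + 1)
      (fun z hz => ((hf.differentiableOn one_ne_zero).differentiableAt
        (hJ.mem_nhds (hsub (hI hz)).1.1)).hasDerivAt.hasDerivWithinAt)
      (fun z hz => (hsub (hI hz)).2.2.le) hη hξ
    simpa using this
  · intro ξ hξ
    exact hF ξ (hsub (hI hξ)).1.1

/-! ### The maximum principle -/

theorem hasDerivAt_deriv_nonpos_of_isLocalMax {g g₁ : ℝ → ℝ} {g₂ x : ℝ}
    (h1 : ∀ r, HasDerivAt g (g₁ r) r) (h2 : HasDerivAt g₁ g₂ x) (hmax : IsLocalMax g x) :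
    g₂ ≤ 0 := by
  have e1 : deriv g = g₁ := funext fun r => (h1 r).deriv
  by_contra! hpos
  have hmin : IsLocalMin g x := isLocalMin_of_deriv_deriv_pos (by rwa [e1, h2.deriv])
    hmax.deriv_eq_zero (h1 x).continuousAt
  have hconst : g =ᶠ[nhds x] fun _ => g x := by
    filter_upwards [hmax, hmin] with r hr hr' using le_antisymm hr hr'
  have := hconst.deriv.deriv_eq
  rw [e1, h2.deriv] at this
  simp at this
  exact hpos.ne' this

theorem hasDerivAt_nonneg_of_le_left {g : ℝ → ℝ} {g' t : ℝ} {a : ℝ} (hat : a < t)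
    (hg : HasDerivAt g g' t) (hle : ∀ r ∈ Ioo a t, g r ≤ g t) : 0 ≤ g' := by
  have h := hg.tendsto_slope.mono_left
    (nhdsWithin_mono t (fun r (hr : r ∈ Iio t) => (mem_Iio.1 hr).ne))
  refine ge_of_tendsto h ?_
  filter_upwards [Ioo_mem_nhdsLT hat] with r hr
  rw [slope_def_field]
  exact div_nonneg_of_nonpos (by linarith [hle r hr]) (by linarith [hr.2])

/-- One-sided maximum principle. The differential inequality is needed only where `w` lies between
`β` and `β + δ`: a strict upper barrier `β + θ exp((Λ + 1) t)` with small `θ` would be touched for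
the first time at a point where `w` takes such a value. -/
theorem le_of_subsolution {L T β δ Λ ε : ℝ} (hL : 0 < L) (hT : 0 < T) (hδ : 0 < δ)
    {w wt wx wxx wy wyy : ℝ → ℝ → ℝ → ℝ}
    (hc : ContinuousOn (fun p : ℝ × ℝ × ℝ => w p.1 p.2.1 p.2.2) (strip T))
    (hpx : ∀ t ∈ Icc 0 T, ∀ x y, w t (x + L) y = w t x y)
    (hpy : ∀ t ∈ Icc 0 T, ∀ x y, w t x (y + L) = w t x y)
    (ht : ∀ t ∈ Ioo 0 T, ∀ x y, HasDerivAt (fun t' => w t' x y) (wt t x y) t)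
    (hx : ∀ t ∈ Ioo 0 T, ∀ x y, HasDerivAt (fun x' => w t x' y) (wx t x y) x)
    (hxx : ∀ t ∈ Ioo 0 T, ∀ x y, HasDerivAt (fun x' => wx t x' y) (wxx t x y) x)
    (hy : ∀ t ∈ Ioo 0 T, ∀ x y, HasDerivAt (fun y' => w t x y') (wy t x y) y)
    (hyy : ∀ t ∈ Ioo 0 T, ∀ x y, HasDerivAt (fun y' => wy t x y') (wyy t x y) y)
    (hpde : ∀ t ∈ Ioo 0 T, ∀ x y, β ≤ w t x y → w t x y ≤ β + δ →
      wt t x y ≤ ε ^ 2 * (wxx t x y + wyy t x y) + Λ * (w t x y - β))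
    (h0 : ∀ x y, w 0 x y ≤ β) :
    ∀ t ∈ Icc 0 T, ∀ x y, w t x y ≤ β := by
  have htime : ∀ x y, ContinuousOn (fun t => w t x y) (Icc 0 T) := fun x y =>
    hc.comp (f := fun t => (t, x, y)) (by fun_prop) (fun t ht => mem_strip.2 ht)
  have hred : ∀ t ∈ Icc 0 T, ∀ x y, ∃ x' ∈ Icc 0 L, ∃ y' ∈ Icc 0 L, w t x y = w t x' y' := by
    intro t htm x y
    have p1 : Function.Periodic (fun x => w t x y) L := fun x => hpx t htm x y
    obtain ⟨x', hx', e1⟩ := p1.exists_mem_Ico₀ hL x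
    have p2 : Function.Periodic (fun y => w t x' y) L := fun y => hpy t htm x' y
    obtain ⟨y', hy', e2⟩ := p2.exists_mem_Ico₀ hL y
    exact ⟨x', Ico_subset_Icc_self hx', y', Ico_subset_Icc_self hy', e1.trans e2⟩
  set b : ℝ → ℝ := fun t => Real.exp ((|Λ| + 1) * t) with hb
  have hbpos : ∀ t, 0 < b t := fun t => Real.exp_pos _
  have hbmono : ∀ {t t'}, t ≤ t' → b t ≤ b t' := fun h =>
    Real.exp_le_exp.2 (mul_le_mul_of_nonneg_left h (by positivity))
  have hbderiv : ∀ t, HasDerivAt b ((|Λ| + 1) * b t) t := fun t => by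
    have := ((hasDerivAt_id t).const_mul (|Λ| + 1)).exp
    simpa [hb, mul_comm] using this
  have barrier : ∀ θ, 0 < θ → θ * b T ≤ δ → ∀ t ∈ Ico 0 T, ∀ x y, w t x y < β + θ * b t := by
    intro θ hθ hθδ t₀ ht₀ x₀ y₀
    by_contra! hbad
    set S : Set (ℝ × ℝ × ℝ) := (Icc 0 t₀ ×ˢ (Icc 0 L ×ˢ Icc 0 L)) ∩
      {p | β ≤ w p.1 p.2.1 p.2.2 - θ * b p.1} with hS
    have hbox : Icc 0 t₀ ×ˢ (Icc 0 L ×ˢ Icc 0 L) ⊆ strip T :=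
      prod_mono (Icc_subset_Icc_right ht₀.2.le) (subset_univ _)
    have hScomp : IsCompact S := by
      have hcl : IsClosed S := by
        refine ContinuousOn.preimage_isClosed_of_isClosed (f := fun p : ℝ × ℝ × ℝ =>
          w p.1 p.2.1 p.2.2 - θ * b p.1) (t := Ici β) ?_ ?_ isClosed_Ici
        · exact (hc.mono hbox).sub (by fun_prop)
        · exact (isCompact_Icc.prod (isCompact_Icc.prod isCompact_Icc)).isClosed
      exact (isCompact_Icc.prod (isCompact_Icc.prod isCompact_Icc)).of_isClosed_subset hcl
        inter_subset_left
    have hSne : S.Nonempty := by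
      obtain ⟨x', hx', y', hy', e⟩ := hred t₀ ⟨ht₀.1, ht₀.2.le⟩ x₀ y₀
      refine ⟨(t₀, x', y'), ⟨⟨ht₀.1, le_rfl⟩, hx', hy'⟩, ?_⟩
      simp only [mem_ofPred_eq]
      linarith
    obtain ⟨⟨t, x, y⟩, hpS, hpmin⟩ := hScomp.exists_isMinOn hSne continuous_fst.continuousOn
    have htt : t ∈ Icc 0 t₀ := hpS.1.1
    have hwge : β ≤ w t x y - θ * b t := hpS.2
    have htpos : 0 < t := by
      rcases htt.1.eq_or_lt with h | h
      · subst h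
        have := h0 x y
        have := mul_pos hθ (hbpos 0)
        linarith
      · exact h
    have htI : t ∈ Ioo 0 T := ⟨htpos, htt.2.trans_lt ht₀.2⟩
    -- below the barrier before the first contact time
    have hbelow : ∀ r ∈ Ioo 0 t, ∀ x y, w r x y - θ * b r < β := by
      intro r hr x' y'
      by_contra! hcon
      obtain ⟨x'', hx'', y'', hy'', e⟩ := hred r ⟨hr.1.le, by linarith [hr.2, htI.2]⟩ x' y'
      have hmem : (r, x'', y'') ∈ S :=
        ⟨⟨⟨hr.1.le, by linarith [hr.2, htt.2]⟩, hx'', hy''⟩, by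
          simp only [mem_ofPred_eq]; rw [← e]; exact hcon⟩
      have := hpmin hmem
      simp only [mem_ofPred_eq] at this
      linarith [hr.2]
    have hat : ∀ x y, w t x y - θ * b t ≤ β := by
      intro x' y'
      have hcont : ContinuousAt (fun r => w r x' y' - θ * b r) t :=
        (ht t htI x' y').continuousAt.sub ((hbderiv t).continuousAt.const_mul θ)
      refine le_of_tendsto (hcont.tendsto.mono_left (nhdsWithin_le_nhds (s := Iio t))) ?_
      filter_upwards [Ioo_mem_nhdsLT htpos] with r hr using (hbelow r hr x' y').le
    have heq : w t x y = β + θ * b t := by linarith [hat x y]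
    have hθb : 0 < θ * b t := mul_pos hθ (hbpos t)
    have d1 : 0 ≤ wt t x y - θ * ((|Λ| + 1) * b t) := by
      refine hasDerivAt_nonneg_of_le_left htpos
        ((ht t htI x y).sub ((hbderiv t).const_mul θ)) ?_
      intro r hr
      have := hbelow r hr x y
      simp only [Pi.sub_apply]
      linarith
    have d2 : wxx t x y ≤ 0 := by
      refine hasDerivAt_deriv_nonpos_of_isLocalMax (fun r => hx t htI r y) (hxx t htI x y) ?_
      exact .of_forall fun r => by linarith [hat r y]
    have d3 : wyy t x y ≤ 0 := by
      refine hasDerivAt_deriv_nonpos_of_isLocalMax (fun r => hy t htI x r) (hyy t htI x y) ?_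
      exact .of_forall fun r => by linarith [hat x r]
    have hle : w t x y ≤ β + δ := by
      have := mul_le_mul_of_nonneg_left (hbmono htI.2.le) hθ.le
      linarith
    have key := hpde t htI x y (by linarith) hle
    rw [heq, add_sub_cancel_left] at key
    have n1 : ε ^ 2 * (wxx t x y + wyy t x y) ≤ 0 :=
      mul_nonpos_of_nonneg_of_nonpos (sq_nonneg _) (by linarith)
    have n2 : Λ * (θ * b t) ≤ |Λ| * (θ * b t) :=
      mul_le_mul_of_nonneg_right (le_abs_self _) hθb.le
    nlinarith
  have hopen : ∀ t ∈ Ico 0 T, ∀ x y, w t x y ≤ β := by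
    intro t htm x y
    refine le_of_forall_pos_le_add fun η hη => ?_
    set θ := min η δ / b T with hθ
    have hmin : 0 < min η δ := lt_min hη hδ
    have hθT : θ * b T = min η δ := div_mul_cancel₀ _ (hbpos T).ne'
    have h := barrier θ (div_pos hmin (hbpos T)) (hθT.le.trans (min_le_right _ _)) t htm x y
    have h' := mul_le_mul_of_nonneg_left (hbmono htm.2.le) (div_pos hmin (hbpos T)).le
    have := min_le_left η δ
    linarith
  intro t htm x y
  rcases htm.2.eq_or_lt with rfl | hlt
  · have hcont := (htime x y t htm).mono (Ico_subset_Icc_self)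
    have hne : t ∈ closure (Ico 0 t) := by
      rw [closure_Ico hT.ne]; exact htm
    exact hcont.closure_le hne continuousWithinAt_const (fun r hr => hopen r hr x y)
  · exact hopen t ⟨htm.1, hlt⟩ x y

section Solution

variable {L T ε β δ K : ℝ} {u : ℝ → ℝ → ℝ → ℝ} {f F : ℝ → ℝ}

/-- Iterated partial derivatives of a function of `(t, x, y)` on the strip. -/
noncomputable def partials (T : ℝ) (u : ℝ → ℝ → ℝ → ℝ) (l : List (Fin 3)) (t x y : ℝ) : ℝ :=
  iterPartial T (fun p => u p.1 p.2.1 p.2.2) l (t, x, y)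

theorem partials_nil : partials T u [] = u := rfl

theorem IsSmoothPeriodic.exists_partials_bound (hL : 0 < L) (hT : 0 < T)
    (hu : IsSmoothPeriodic L T u) :
    ∃ B : ℝ, 0 ≤ B ∧ ∀ l : List (Fin 3), l.length ≤ 4 → ∀ t ∈ Icc 0 T, ∀ x y,
      |partials T u l t x y| ≤ B := by
  obtain ⟨B, hB0, hB⟩ := hu.isPeriodicCn.exists_iterPartial_bound hL hT
  exact ⟨B, hB0, fun l hl t ht x y => hB l hl _ (mem_strip.2 ht)⟩

theorem IsSmoothPeriodic.isPeriodicCn_iterPartial (hT : 0 < T) (hu : IsSmoothPeriodic L T u)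
    {l : List (Fin 3)} (hl : l.length < 4) :
    IsPeriodicCn L T (4 - l.length) (iterPartial T (fun p => u p.1 p.2.1 p.2.2) l) := by
  refine IsPeriodicCn.iterPartial hT l ?_
  rw [Nat.sub_add_cancel hl.le]
  exact hu.isPeriodicCn

theorem IsSmoothPeriodic.hasDerivAt_time (hT : 0 < T) (hu : IsSmoothPeriodic L T u)
    {l : List (Fin 3)} (hl : l.length < 4) {t : ℝ} (ht : t ∈ Ioo 0 T) (x y : ℝ) :
    HasDerivAt (fun t' => partials T u l t' x y) (partials T u (0 :: l) t x y) t :=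
  (hu.isPeriodicCn_iterPartial hT hl).hasDerivAt_time (Nat.sub_ne_zero_of_lt hl) ht x y

theorem IsSmoothPeriodic.hasDerivAt_x (hT : 0 < T) (hu : IsSmoothPeriodic L T u)
    {l : List (Fin 3)} (hl : l.length < 4) {t : ℝ} (ht : t ∈ Icc 0 T) (x y : ℝ) :
    HasDerivAt (fun x' => partials T u l t x' y) (partials T u (1 :: l) t x y) x :=
  (hu.isPeriodicCn_iterPartial hT hl).hasDerivAt_x (Nat.sub_ne_zero_of_lt hl) ht x y

theorem IsSmoothPeriodic.hasDerivAt_y (hT : 0 < T) (hu : IsSmoothPeriodic L T u)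
    {l : List (Fin 3)} (hl : l.length < 4) {t : ℝ} (ht : t ∈ Icc 0 T) (x y : ℝ) :
    HasDerivAt (fun y' => partials T u l t x y') (partials T u (2 :: l) t x y) y :=
  (hu.isPeriodicCn_iterPartial hT hl).hasDerivAt_y (Nat.sub_ne_zero_of_lt hl) ht x y

theorem IsSmoothPeriodic.continuousOn_time (hT : 0 < T) (hu : IsSmoothPeriodic L T u)
    {l : List (Fin 3)} (hl : l.length < 4) (x y : ℝ) :
    ContinuousOn (fun t => partials T u l t x y) (Icc 0 T) :=
  (hu.isPeriodicCn_iterPartial hT hl).continuousOn_time x y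

theorem SolvesReactionDiffusion.partials_eq (hT : 0 < T) (hu : IsSmoothPeriodic L T u)
    (hpde : SolvesReactionDiffusion T ε f u) {t : ℝ} (ht : t ∈ Ioo 0 T) (x y : ℝ) :
    partials T u [0] t x y
      = ε ^ 2 * (partials T u [1, 1] t x y + partials T u [2, 2] t x y) + f (u t x y) := by
  have ht' := Ioo_subset_Icc_self ht
  have h := hpde t ht x y
  have e0 : deriv (fun t' => u t' x y) t = partials T u [0] t x y :=
    (hu.hasDerivAt_time hT (l := []) (by simp) ht x y).deriv
  have e1 : iteratedDeriv 2 (fun x' => u t x' y) x = partials T u [1, 1] t x y := by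
    have : deriv (fun x' => u t x' y) = fun x' => partials T u [1] t x' y :=
      funext fun r => (hu.hasDerivAt_x hT (l := []) (by simp) ht' r y).deriv
    rw [iteratedDeriv_succ, iteratedDeriv_one, this]
    exact (hu.hasDerivAt_x hT (l := [1]) (by simp) ht' x y).deriv
  have e2 : iteratedDeriv 2 (fun y' => u t x y') y = partials T u [2, 2] t x y := by
    have : deriv (fun y' => u t x y') = fun y' => partials T u [2] t x y' :=
      funext fun r => (hu.hasDerivAt_y hT (l := []) (by simp) ht' x r).deriv
    rw [iteratedDeriv_succ, iteratedDeriv_one, this]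
    exact (hu.hasDerivAt_y hT (l := [2]) (by simp) ht' x y).deriv
  rwa [e0, e1, e2] at h

/-- Maximum bound principle for the differential equation. -/
theorem SolvesReactionDiffusion.maximum_bound (hL : 0 < L) (hT : 0 < T) (hβ : 0 < β) (hδ : 0 < δ)
    (hu : IsSmoothPeriodic L T u) (hpde : SolvesReactionDiffusion T ε f u)
    (hf : IsTameOn K (β + δ) f F) (hfβ : f β ≤ 0) (hfβ' : 0 ≤ f (-β))
    (h0 : ∀ x y, |u 0 x y| ≤ β) : ∀ t ∈ Icc 0 T, ∀ x y, |u t x y| ≤ β := by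
  have up : ∀ t ∈ Icc 0 T, ∀ x y, u t x y ≤ β := by
    refine le_of_subsolution (wt := partials T u [0]) (wx := partials T u [1])
      (wxx := partials T u [1, 1]) (wy := partials T u [2]) (wyy := partials T u [2, 2])
      (Λ := K) (ε := ε) hL hT hδ hu.smooth.continuousOn hu.periodic_x hu.periodic_y
      (fun t ht x y => hu.hasDerivAt_time hT (l := []) (by simp) ht x y)
      (fun t ht x y => hu.hasDerivAt_x hT (l := []) (by simp) (Ioo_subset_Icc_self ht) x y)
      (fun t ht x y => hu.hasDerivAt_x hT (l := [1]) (by simp) (Ioo_subset_Icc_self ht) x y)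
      (fun t ht x y => hu.hasDerivAt_y hT (l := []) (by simp) (Ioo_subset_Icc_self ht) x y)
      (fun t ht x y => hu.hasDerivAt_y hT (l := [2]) (by simp) (Ioo_subset_Icc_self ht) x y)
      (fun t ht x y hlo hhi => ?_) (fun x y => (abs_le.1 (h0 x y)).2)
    rw [hpde.partials_eq hT hu ht]
    have := hf.lipschitz (u t x y) ⟨by linarith, hhi⟩ β ⟨by linarith, by linarith⟩
    rw [abs_of_nonneg (sub_nonneg.2 hlo)] at this
    have := (abs_le.1 this).2
    linarith
  have dn : ∀ t ∈ Icc 0 T, ∀ x y, -u t x y ≤ β := by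
    refine le_of_subsolution (w := fun t x y => -u t x y)
      (wt := fun t x y => -partials T u [0] t x y)
      (wx := fun t x y => -partials T u [1] t x y)
      (wxx := fun t x y => -partials T u [1, 1] t x y) (wy := fun t x y => -partials T u [2] t x y)
      (wyy := fun t x y => -partials T u [2, 2] t x y)
      (Λ := K) (ε := ε) hL hT hδ hu.smooth.continuousOn.neg
      (fun t ht x y => by rw [hu.periodic_x t ht]) (fun t ht x y => by rw [hu.periodic_y t ht])
      (fun t ht x y => (hu.hasDerivAt_time hT (l := []) (by simp) ht x y).neg)
      (fun t ht x y => (hu.hasDerivAt_x hT (l := []) (by simp) (Ioo_subset_Icc_self ht) x y).neg)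
      (fun t ht x y => (hu.hasDerivAt_x hT (l := [1]) (by simp) (Ioo_subset_Icc_self ht) x y).neg)
      (fun t ht x y => (hu.hasDerivAt_y hT (l := []) (by simp) (Ioo_subset_Icc_self ht) x y).neg)
      (fun t ht x y => (hu.hasDerivAt_y hT (l := [2]) (by simp) (Ioo_subset_Icc_self ht) x y).neg)
      (fun t ht x y hlo hhi => ?_) (fun x y => by linarith [(abs_le.1 (h0 x y)).1])
    rw [hpde.partials_eq hT hu ht]
    have := hf.lipschitz (-β) ⟨by linarith, by linarith⟩ (u t x y) ⟨by linarith, by linarith⟩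
    rw [abs_of_nonneg (a := -β - u t x y) (by linarith)] at this
    have := (abs_le.1 this).2
    linarith
  exact fun t ht x y => abs_le.2 ⟨by linarith [dn t ht x y], up t ht x y⟩

end Solution

/-! ### Consistency of the scheme -/

section Consistency

variable {L T ε K a B : ℝ} {u : ℝ → ℝ → ℝ → ℝ} {f F : ℝ → ℝ}

/-- Truncation error of the five-point Laplacian. -/
theorem abs_five_point_sub_le (hT : 0 < T) (hu : IsSmoothPeriodic L T u)
    (hB : ∀ l : List (Fin 3), l.length ≤ 4 → ∀ t ∈ Icc 0 T, ∀ x y, |partials T u l t x y| ≤ B)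
    {t h : ℝ} (ht : t ∈ Icc 0 T) (hh : 0 < h) (x y : ℝ) :
    |(u t (x + h) y + u t (x - h) y + u t x (y + h) + u t x (y - h) - 4 * u t x y) / h ^ 2
      - (partials T u [1, 1] t x y + partials T u [2, 2] t x y)| ≤ 4 * B * h ^ 2 := by
  have dx : ∀ l : List (Fin 3), l.length < 4 → ∀ r, HasDerivAt (fun x' => partials T u l t x' y)
      (partials T u (1 :: l) t r y) r := fun l hl r => hu.hasDerivAt_x hT hl ht r y
  have dy : ∀ l : List (Fin 3), l.length < 4 → ∀ r, HasDerivAt (fun y' => partials T u l t x y')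
      (partials T u (2 :: l) t x r) r := fun l hl r => hu.hasDerivAt_y hT hl ht x r
  have h1 := abs_second_diff_sub_deriv_le (m := x) hh.le
    (fun r _ => (dx [] (by simp) r).continuousAt.continuousWithinAt)
    (fun r _ => dx [] (by simp) r) (fun r _ => dx [1] (by simp) r)
    (fun r _ => dx [1, 1] (by simp) r) (fun r _ => dx [1, 1, 1] (by simp) r)
    (fun r _ => hB [1, 1, 1, 1] (by simp) t ht r y)
  have h2 := abs_second_diff_sub_deriv_le (m := y) hh.le
    (fun r _ => (dy [] (by simp) r).continuousAt.continuousWithinAt)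
    (fun r _ => dy [] (by simp) r) (fun r _ => dy [2] (by simp) r)
    (fun r _ => dy [2, 2] (by simp) r) (fun r _ => dy [2, 2, 2] (by simp) r)
    (fun r _ => hB [2, 2, 2, 2] (by simp) t ht x r)
  rw [partials_nil] at h1 h2
  have hh2 : 0 < h ^ 2 := by positivity
  rw [div_sub' hh2.ne', abs_div, abs_of_pos hh2, div_le_iff₀ hh2]
  have e : u t (x + h) y + u t (x - h) y + u t x (y + h) + u t x (y - h) - 4 * u t x y
      - h ^ 2 * (partials T u [1, 1] t x y + partials T u [2, 2] t x y)
      = (u t (x + h) y + u t (x - h) y - 2 * u t x y - h ^ 2 * partials T u [1, 1] t x y)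
        + (u t x (y + h) + u t x (y - h) - 2 * u t x y - h ^ 2 * partials T u [2, 2] t x y) := by
    ring
  rw [e]
  refine (abs_add_le _ _).trans ((add_le_add h1 h2).trans (le_of_eq ?_))
  ring

theorem abs_sub_le_of_time (hT : 0 < T) (hu : IsSmoothPeriodic L T u)
    (hB : ∀ l : List (Fin 3), l.length ≤ 4 → ∀ t ∈ Icc 0 T, ∀ x y, |partials T u l t x y| ≤ B)
    {t t' : ℝ} (ht : 0 ≤ t) (htt : t ≤ t') (ht' : t' ≤ T) (x y : ℝ) :
    |u t' x y - u t x y| ≤ B * (t' - t) := by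
  have hsub : ∀ r ∈ Ioo t t', r ∈ Ioo 0 T := fun r hr => ⟨by linarith [hr.1], by linarith [hr.2]⟩
  exact abs_sub_le_of_hasDerivAt htt ((hu.continuousOn_time hT (l := []) (by simp) x y).mono
    (Icc_subset_Icc ht ht')) (fun r hr => hu.hasDerivAt_time hT (l := []) (by simp) (hsub r hr) x y)
    (fun r hr => hB [0] (by simp) r (Ioo_subset_Icc_self (hsub r hr)) x y)

/-- Truncation error of the corrector for `u`: all terms are expanded about the midpoint in time,
where the differential equation holds. -/
theorem abs_corrector_truncation_le (hT : 0 < T) (hu : IsSmoothPeriodic L T u)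
    (hpde : SolvesReactionDiffusion T ε f u)
    (hB : ∀ l : List (Fin 3), l.length ≤ 4 → ∀ t ∈ Icc 0 T, ∀ x y, |partials T u l t x y| ≤ B)
    {m s h : ℝ} (hs : 0 < s) (hm : 0 ≤ m - s) (hm' : m + s ≤ T) (hh : 0 < h) (x y : ℝ) :
    |u (m + s) x y - u (m - s) x y - 2 * s * (ε ^ 2 * (1 / 2 *
        ((u (m + s) (x + h) y + u (m + s) (x - h) y + u (m + s) x (y + h) + u (m + s) x (y - h)
          - 4 * u (m + s) x y) / h ^ 2
        + (u (m - s) (x + h) y + u (m - s) (x - h) y + u (m - s) x (y + h) + u (m - s) x (y - h)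
          - 4 * u (m - s) x y) / h ^ 2)) + f (u m x y))|
      ≤ 2 * s * (B * (1 + 4 * ε ^ 2) * ((2 * s) ^ 2 + h ^ 2)) := by
  have hB0 : 0 ≤ B := (abs_nonneg _).trans (hB [] (by simp) 0 ⟨le_rfl, hT.le⟩ 0 0)
  have hI : ∀ r ∈ Ioo (m - s) (m + s), r ∈ Ioo 0 T := fun r hr =>
    ⟨by linarith [hr.1], by linarith [hr.2]⟩
  have hIc : Icc (m - s) (m + s) ⊆ Icc 0 T := Icc_subset_Icc hm hm'
  have hmI : m ∈ Ioo 0 T := ⟨by linarith, by linarith⟩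
  have c : ∀ l : List (Fin 3), l.length < 4 →
      ContinuousOn (fun r => partials T u l r x y) (Icc (m - s) (m + s)) :=
    fun l hl => (hu.continuousOn_time hT hl x y).mono hIc
  have d : ∀ l : List (Fin 3), l.length < 4 → ∀ r ∈ Ioo (m - s) (m + s),
      HasDerivAt (fun r => partials T u l r x y) (partials T u (0 :: l) r x y) r :=
    fun l hl r hr => hu.hasDerivAt_time hT hl (hI r hr) x y
  have b : ∀ l : List (Fin 3), l.length ≤ 4 → ∀ r ∈ Ioo (m - s) (m + s),
      |partials T u l r x y| ≤ B :=
    fun l hl r hr => hB l hl r (Ioo_subset_Icc_self (hI r hr)) x y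
  have k1 := abs_central_sub_deriv_le hs.le (c [] (by simp)) (d [] (by simp)) (d [0] (by simp))
    (d [0, 0] (by simp)) (b [0, 0, 0] (by simp))
  rw [partials_nil] at k1
  have k2 := abs_second_diff_le hs.le (c [1, 1] (by simp)) (d [1, 1] (by simp))
    (d [0, 1, 1] (by simp)) (b [0, 0, 1, 1] (by simp))
  have k3 := abs_second_diff_le hs.le (c [2, 2] (by simp)) (d [2, 2] (by simp))
    (d [0, 2, 2] (by simp)) (b [0, 0, 2, 2] (by simp))
  have k4 := abs_five_point_sub_le hT hu hB (t := m + s) ⟨by linarith, hm'⟩ hh x y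
  have k5 := abs_five_point_sub_le hT hu hB (t := m - s) ⟨hm, by linarith⟩ hh x y
  have k6 := hpde.partials_eq hT hu hmI x y
  generalize (u (m + s) (x + h) y + u (m + s) (x - h) y + u (m + s) x (y + h) + u (m + s) x (y - h)
          - 4 * u (m + s) x y) / h ^ 2 = Q1 at *
  generalize (u (m - s) (x + h) y + u (m - s) (x - h) y + u (m - s) x (y + h) + u (m - s) x (y - h)
          - 4 * u (m - s) x y) / h ^ 2 = Q2 at *
  rw [k6] at k1
  generalize partials T u [1, 1] (m + s) x y = X1 at *
  generalize partials T u [1, 1] (m - s) x y = X2 at *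
  generalize partials T u [1, 1] m x y = X0 at *
  generalize partials T u [2, 2] (m + s) x y = Y1 at *
  generalize partials T u [2, 2] (m - s) x y = Y2 at *
  generalize partials T u [2, 2] m x y = Y0 at *
  have e : u (m + s) x y - u (m - s) x y - 2 * s * (ε ^ 2 * (1 / 2 * (Q1 + Q2)) + f (u m x y))
      = (u (m + s) x y - u (m - s) x y - 2 * s * (ε ^ 2 * (X0 + Y0) + f (u m x y)))
        - s * ε ^ 2 * ((X1 + X2 - 2 * X0) + (Y1 + Y2 - 2 * Y0)
          + ((Q1 - (X1 + Y1)) + (Q2 - (X2 + Y2)))) := by ring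
  have hin : |(X1 + X2 - 2 * X0) + (Y1 + Y2 - 2 * Y0) + ((Q1 - (X1 + Y1)) + (Q2 - (X2 + Y2)))|
      ≤ 4 * B * s ^ 2 + 8 * B * h ^ 2 := by
    rw [abs_le] at *
    constructor <;> linarith [k2.1, k2.2, k3.1, k3.2, k4.1, k4.2, k5.1, k5.2]
  rw [e]
  refine (abs_sub _ _).trans ?_
  rw [abs_mul, abs_of_nonneg (by positivity : 0 ≤ s * ε ^ 2)]
  have hin' := mul_le_mul_of_nonneg_left hin (by positivity : 0 ≤ s * ε ^ 2)
  refine (add_le_add k1 hin').trans ?_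
  have p1 : 0 ≤ s * B * s ^ 2 := by positivity
  have p2 : 0 ≤ s * B * h ^ 2 := by positivity
  have p3 : 0 ≤ s * B * ε ^ 2 * s ^ 2 := by positivity
  have p4 : 0 ≤ s * B * ε ^ 2 * h ^ 2 := by positivity
  nlinarith

/-- Truncation error of the predictor for `u`. The equation is used at the new time, which is an
interior point, and the explicit treatment of `f` costs one order. -/
theorem abs_predictor_truncation_le (hT : 0 < T) (hu : IsSmoothPeriodic L T u)
    (hpde : SolvesReactionDiffusion T ε f u) (ha : 0 ≤ a) (hf : IsTameOn K a f F)
    (hua : ∀ t ∈ Icc 0 T, ∀ x y, u t x y ∈ Icc (-a) a)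
    (hB : ∀ l : List (Fin 3), l.length ≤ 4 → ∀ t ∈ Icc 0 T, ∀ x y, |partials T u l t x y| ≤ B)
    {t s h : ℝ} (hs : 0 < s) (ht : 0 ≤ t) (ht' : t + s < T) (hh : 0 < h) (x y : ℝ) :
    |u (t + s) x y - u t x y - s * (ε ^ 2 *
        ((u (t + s) (x + h) y + u (t + s) (x - h) y + u (t + s) x (y + h) + u (t + s) x (y - h)
          - 4 * u (t + s) x y) / h ^ 2) + f (u t x y))|
      ≤ s * (B * (1 + 4 * ε ^ 2 + K) * (s + h ^ 2)) := by
  have hB0 : 0 ≤ B := (abs_nonneg _).trans (hB [] (by simp) 0 ⟨le_rfl, hT.le⟩ 0 0)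
  have hK0 := hf.nonneg ha
  have hmI : t + s ∈ Ioo 0 T := ⟨by linarith, by linarith⟩
  have k1 : |(u (t + s) x y - (t + s) * partials T u [0] (t + s) x y)
      - (u t x y - t * partials T u [0] (t + s) x y)| ≤ B * s * (t + s - t) := by
    refine abs_sub_le_of_hasDerivAt (q := fun r => u r x y - r * partials T u [0] (t + s) x y)
      (q' := fun r => partials T u [0] r x y - 1 * partials T u [0] (t + s) x y) (by linarith)
      (((hu.continuousOn_time hT (l := []) (by simp) x y).mono
        (Icc_subset_Icc ht ht'.le)).sub (by fun_prop)) ?_ ?_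
    · intro r hr
      exact (hu.hasDerivAt_time hT (l := []) (by simp) ⟨by linarith [hr.1], by linarith [hr.2]⟩
        x y).sub ((hasDerivAt_id r).mul_const _)
    · intro r hr
      have := abs_sub_le_of_hasDerivAt (q := fun r => partials T u [0] r x y) hr.2.le
        ((hu.continuousOn_time hT (l := [0]) (by simp) x y).mono
          (Icc_subset_Icc (by linarith [hr.1]) ht'.le))
        (fun z hz => hu.hasDerivAt_time hT (l := [0]) (by simp)
          ⟨by linarith [hr.1, hz.1], by linarith [hz.2]⟩ x y)
        (fun z hz => hB [0, 0] (by simp) z ⟨by linarith [hr.1, hz.1], by linarith [hz.2]⟩ x y)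
      rw [one_mul, abs_sub_comm]
      refine this.trans (mul_le_mul_of_nonneg_left (by linarith [hr.1]) hB0)
  have k2 := abs_five_point_sub_le hT hu hB (t := t + s) ⟨by linarith, ht'.le⟩ hh x y
  have k3 : |f (u (t + s) x y) - f (u t x y)| ≤ K * (B * s) := by
    refine (hf.lipschitz _ (hua _ (Ioo_subset_Icc_self hmI) x y) _
      (hua t ⟨ht, by linarith⟩ x y)).trans (mul_le_mul_of_nonneg_left ?_ hK0)
    simpa using abs_sub_le_of_time hT hu hB ht (by linarith : t ≤ t + s) ht'.le x y
  have k6 := hpde.partials_eq hT hu hmI x y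
  generalize (u (t + s) (x + h) y + u (t + s) (x - h) y + u (t + s) x (y + h) + u (t + s) x (y - h)
          - 4 * u (t + s) x y) / h ^ 2 = Q at *
  rw [k6] at k1
  generalize partials T u [1, 1] (t + s) x y = X at *
  generalize partials T u [2, 2] (t + s) x y = Y at *
  generalize f (u (t + s) x y) = f1 at *
  generalize f (u t x y) = f0 at *
  have e : u (t + s) x y - u t x y - s * (ε ^ 2 * Q + f0)
      = ((u (t + s) x y - (t + s) * (ε ^ 2 * (X + Y) + f1))
          - (u t x y - t * (ε ^ 2 * (X + Y) + f1)))
        + s * ((f1 - f0) - ε ^ 2 * (Q - (X + Y))) := by ring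
  have hin : |(f1 - f0) - ε ^ 2 * (Q - (X + Y))| ≤ K * (B * s) + ε ^ 2 * (4 * B * h ^ 2) := by
    refine (abs_sub _ _).trans (add_le_add k3 ?_)
    rw [abs_mul, abs_of_nonneg (sq_nonneg ε)]
    exact mul_le_mul_of_nonneg_left k2 (sq_nonneg ε)
  rw [e]
  refine (abs_add_le _ _).trans ?_
  rw [abs_mul s, abs_of_pos hs]
  refine (add_le_add k1 (mul_le_mul_of_nonneg_left hin hs.le)).trans ?_
  have p1 : 0 ≤ s * (B * h ^ 2) := by positivity
  have p2 : 0 ≤ s * (B * ε ^ 2 * s) := by positivity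
  have p3 : 0 ≤ s * (B * K * h ^ 2) := by positivity
  nlinarith

/-- Truncation error of the corrector for the auxiliary variable. The nonlinearity is only `C¹`, but
along the solution it equals `u_t - ε² Δu`, which is twice differentiable in time. -/
theorem abs_potential_truncation_le (hT : 0 < T) (hu : IsSmoothPeriodic L T u)
    (hpde : SolvesReactionDiffusion T ε f u) (hf : IsTameOn K a f F)
    (hua : ∀ t ∈ Icc 0 T, ∀ x y, u t x y ∈ Icc (-a) a)
    (hB : ∀ l : List (Fin 3), l.length ≤ 4 → ∀ t ∈ Icc 0 T, ∀ x y, |partials T u l t x y| ≤ B)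
    {m s : ℝ} (hs : 0 < s) (hm : 0 ≤ m - s) (hm' : m + s ≤ T) (x y : ℝ) :
    |F (u (m + s) x y) - F (u (m - s) x y) + f (u m x y) * (u (m + s) x y - u (m - s) x y)|
      ≤ 4 * (B * (1 + 2 * ε ^ 2)) ^ 2 * s ^ 3 := by
  have hB0 : 0 ≤ B := (abs_nonneg _).trans (hB [] (by simp) 0 ⟨le_rfl, hT.le⟩ 0 0)
  have hI : ∀ r ∈ Ioo (m - s) (m + s), r ∈ Ioo 0 T := fun r hr =>
    ⟨by linarith [hr.1], by linarith [hr.2]⟩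
  have hIc : Icc (m - s) (m + s) ⊆ Icc 0 T := Icc_subset_Icc hm hm'
  have hmI : m ∈ Ioo 0 T := ⟨by linarith, by linarith⟩
  have d : ∀ l : List (Fin 3), l.length < 4 → ∀ r ∈ Ioo (m - s) (m + s),
      HasDerivAt (fun r => partials T u l r x y) (partials T u (0 :: l) r x y) r :=
    fun l hl r hr => hu.hasDerivAt_time hT hl (hI r hr) x y
  have b : ∀ l : List (Fin 3), l.length ≤ 4 → ∀ r ∈ Ioo (m - s) (m + s),
      |partials T u l r x y| ≤ B :=
    fun l hl r hr => hB l hl r (Ioo_subset_Icc_self (hI r hr)) x y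
  have hBB : B ≤ B * (1 + 2 * ε ^ 2) := le_mul_of_one_le_right hB0 (by nlinarith [sq_nonneg ε])
  have hcomb : ∀ {p q r : ℝ}, |p| ≤ B → |q| ≤ B → |r| ≤ B →
      |p - ε ^ 2 * (q + r)| ≤ B * (1 + 2 * ε ^ 2) := by
    intro p q r hp hq hr
    refine (abs_sub _ _).trans ?_
    rw [abs_mul, abs_of_nonneg (sq_nonneg ε)]
    have := (abs_add_le q r).trans (add_le_add hq hr)
    have := mul_le_mul_of_nonneg_left this (sq_nonneg ε)
    linarith
  have key := abs_midpoint_stieltjes_le (P := fun r => F (u r x y)) (w := fun r => u r x y)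
    (w₁ := fun r => partials T u [0] r x y) (w₂ := fun r => partials T u [0, 0] r x y)
    (φ := fun r => partials T u [0] r x y
      - ε ^ 2 * (partials T u [1, 1] r x y + partials T u [2, 2] r x y))
    (φ₁ := fun r => partials T u [0, 0] r x y
      - ε ^ 2 * (partials T u [0, 1, 1] r x y + partials T u [0, 2, 2] r x y))
    (φ₂ := fun r => partials T u [0, 0, 0] r x y
      - ε ^ 2 * (partials T u [0, 0, 1, 1] r x y + partials T u [0, 0, 2, 2] r x y))
    (m := m) (B := B * (1 + 2 * ε ^ 2)) hs.le
    (fun r hr => ((hf.hasDerivAt _ (hua r (hIc hr) x y)).continuousAt.comp_continuousWithinAt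
      (f := fun r => u r x y)
      ((hu.continuousOn_time hT (l := []) (by simp) x y r (hIc hr)).mono hIc)))
    ((hu.continuousOn_time hT (l := []) (by simp) x y).mono hIc)
    (d [] (by simp)) (d [0] (by simp)) (fun r hr => ?_)
    (fun r hr => (d [0] (by simp) r hr).sub
      (((d [1, 1] (by simp) r hr).add (d [2, 2] (by simp) r hr)).const_mul _))
    (fun r hr => (d [0, 0] (by simp) r hr).sub
      (((d [0, 1, 1] (by simp) r hr).add (d [0, 2, 2] (by simp) r hr)).const_mul _))
    (fun r hr => (b [0] (by simp) r hr).trans hBB)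
    (fun r hr => (b [0, 0] (by simp) r hr).trans hBB)
    (fun r hr => hcomb (b _ (by simp) r hr) (b _ (by simp) r hr) (b _ (by simp) r hr))
    (fun r hr => hcomb (b _ (by simp) r hr) (b _ (by simp) r hr) (b _ (by simp) r hr))
  · rwa [hpde.partials_eq hT hu hmI, add_sub_cancel_left] at key
  · have h1 := (hf.hasDerivAt _ (hua r (Ioo_subset_Icc_self (hI r hr)) x y)).comp r
      (d [] (by simp) r hr)
    refine h1.congr_deriv ?_
    have := hpde.partials_eq hT hu (hI r hr) x y
    rw [show partials T u [0] r x y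
        - ε ^ 2 * (partials T u [1, 1] r x y + partials T u [2, 2] r x y)
      = f (u r x y) by linarith]

end Consistency

/-! ### Mesh values of periodic functions -/

theorem dLap_half_add {M : ℕ} {h : ℝ} (v w : GridFn M) (p : ZMod M × ZMod M) :
    dLap h ((1 / 2 : ℝ) • (v + w)) p = 1 / 2 * (dLap h v p + dLap h w p) := by
  simp only [dLap, Pi.smul_apply, Pi.add_apply, smul_eq_mul]
  ring

section Mesh

variable {M : ℕ} [NeZero M] {L h : ℝ}

theorem periodic_zmod_intCast {φ : ℝ → ℝ} (hφ : Function.Periodic φ L) (hL : L = M * h) (k : ℤ) :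
    φ (((k : ZMod M).val : ℝ) * h) = φ (k * h) := by
  have h1 : (((k : ZMod M).val : ℤ) : ℝ) = ((k % (M : ℤ) : ℤ) : ℝ) := by
    rw [ZMod.val_intCast]
  have h2 : (k : ℝ) = ((k % (M : ℤ) : ℤ) : ℝ) + (M : ℝ) * ((k / (M : ℤ) : ℤ) : ℝ) := by
    exact_mod_cast (Int.emod_add_mul_ediv k M).symm
  have h3 : (k : ℝ) * h = ((k % (M : ℤ) : ℤ) : ℝ) * h + ((k / (M : ℤ) : ℤ) : ℝ) * L := by
    rw [hL]; nth_rewrite 1 [h2]; ring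
  rw [h3, hφ.int_mul, ← h1]
  norm_cast

theorem periodic_zmod_add_one {φ : ℝ → ℝ} (hφ : Function.Periodic φ L) (hL : L = M * h)
    (i : ZMod M) : φ (((i + 1).val : ℝ) * h) = φ ((i.val : ℝ) * h + h) := by
  have := periodic_zmod_intCast hφ hL ((i.val : ℤ) + 1)
  push_cast [ZMod.natCast_zmod_val] at this
  rw [this]; congr 1; ring

theorem periodic_zmod_sub_one {φ : ℝ → ℝ} (hφ : Function.Periodic φ L) (hL : L = M * h)
    (i : ZMod M) : φ (((i - 1).val : ℝ) * h) = φ ((i.val : ℝ) * h - h) := by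
  have := periodic_zmod_intCast hφ hL ((i.val : ℤ) - 1)
  push_cast [ZMod.natCast_zmod_val] at this
  rw [this]; congr 1; ring

theorem dLap_restrict {φ : ℝ → ℝ → ℝ} (hx : ∀ x y, φ (x + L) y = φ x y)
    (hy : ∀ x y, φ x (y + L) = φ x y) (hL : L = M * h) (p : ZMod M × ZMod M) :
    dLap h (restrict M h φ) p
      = (φ ((p.1.val : ℝ) * h + h) ((p.2.val : ℝ) * h)
        + φ ((p.1.val : ℝ) * h - h) ((p.2.val : ℝ) * h)
        + φ ((p.1.val : ℝ) * h) ((p.2.val : ℝ) * h + h)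
        + φ ((p.1.val : ℝ) * h) ((p.2.val : ℝ) * h - h)
        - 4 * φ ((p.1.val : ℝ) * h) ((p.2.val : ℝ) * h)) / h ^ 2 := by
  have px : ∀ y, Function.Periodic (fun x => φ x y) L := fun y x => hx x y
  have py : ∀ x, Function.Periodic (fun y => φ x y) L := fun x y => hy x y
  have a1 := periodic_zmod_add_one (px ((p.2.val : ℝ) * h)) hL p.1
  have a2 := periodic_zmod_sub_one (px ((p.2.val : ℝ) * h)) hL p.1
  have a3 := periodic_zmod_add_one (py ((p.1.val : ℝ) * h)) hL p.2
  have a4 := periodic_zmod_sub_one (py ((p.1.val : ℝ) * h)) hL p.2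
  simp only [dLap, restrict]
  rw [a1, a2, a3, a4]

/-- The mesh functions `U₀`, `Um`, `U₁`, thought of as the exact solution at the times `t`,
`t + τ / 2`, `t + τ`, satisfy the equations of the scheme, with `g = 1` and without the stabilizing
terms, up to the truncation errors of a second-order method with a first-order predictor. -/
structure IsConsistent (A h τ ε : ℝ) (f F : ℝ → ℝ) (U₀ Um U₁ : GridFn M) : Prop where
  predictor : ∀ p, |Um p - U₀ p - τ / 2 * (ε ^ 2 * dLap h Um p + f (U₀ p))|
    ≤ τ * (A * (τ + h ^ 2))
  corrector : ∀ p, |U₁ p - U₀ p - τ * (ε ^ 2 * dLap h ((1 / 2 : ℝ) • (U₁ + U₀)) p + f (Um p))|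
    ≤ τ * (A * (τ ^ 2 + h ^ 2))
  potential_predictor : ∀ p, |F (Um p) - F (U₀ p) + f (U₀ p) * (Um p - U₀ p)| ≤ A * τ ^ 2
  potential_corrector : ∀ p, |F (U₁ p) - F (U₀ p) + f (Um p) * (U₁ p - U₀ p)| ≤ τ * (A * τ ^ 2)
  half_step : ∀ p, |Um p - U₀ p| ≤ A * τ
  full_step : ∀ p, |U₁ p - U₀ p| ≤ A * τ
  average : ∀ p, |1 / 2 * (U₁ p + U₀ p) - Um p| ≤ A * τ ^ 2

end Mesh

/-! ### Consistency of the mesh values of the solution -/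

/-- Bound for all truncation errors, in terms of a bound `B` for the derivatives of the solution and
a bound `K` for the nonlinearity and its Lipschitz constant. -/
noncomputable def truncationConst (B K ε : ℝ) : ℝ :=
  B * (1 + 4 * ε ^ 2 + K) + K * B ^ 2 + 4 * (B * (1 + 2 * ε ^ 2)) ^ 2

theorem truncationConst_nonneg {B K ε : ℝ} (hB : 0 ≤ B) (hK : 0 ≤ K) :
    0 ≤ truncationConst B K ε := by
  unfold truncationConst; positivity

theorem isConsistent_restrict {L T ε K a B : ℝ} {u : ℝ → ℝ → ℝ → ℝ} {f F : ℝ → ℝ} {M : ℕ}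
    [NeZero M] {h : ℝ} (hT : 0 < T) (hu : IsSmoothPeriodic L T u)
    (hpde : SolvesReactionDiffusion T ε f u) (ha : 0 ≤ a) (hf : IsTameOn K a f F)
    (hua : ∀ t ∈ Icc 0 T, ∀ x y, u t x y ∈ Icc (-a) a)
    (hB : ∀ l : List (Fin 3), l.length ≤ 4 → ∀ t ∈ Icc 0 T, ∀ x y, |partials T u l t x y| ≤ B)
    (hL : L = M * h) (hh : 0 < h) {t τ : ℝ} (hτ : 0 < τ) (ht : 0 ≤ t) (ht' : t + τ ≤ T) :
    IsConsistent (truncationConst B K ε) h τ ε f F (restrict M h (u t))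
      (restrict M h (u (t + τ / 2))) (restrict M h (u (t + τ))) := by
  have hB0 : 0 ≤ B := (abs_nonneg _).trans (hB [] (by simp) 0 ⟨le_rfl, hT.le⟩ 0 0)
  have hK0 := hf.nonneg ha
  have mem : ∀ r, t ≤ r → r ≤ t + τ → r ∈ Icc 0 T := fun r h1 h2 => ⟨by linarith, by linarith⟩
  have q1 : 0 ≤ K * B ^ 2 := by positivity
  have q2 : 0 ≤ 4 * (B * (1 + 2 * ε ^ 2)) ^ 2 := by positivity
  have q3 : 0 ≤ B * K := by positivity
  have q4 : 0 ≤ B * ε ^ 2 := by positivity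
  have A0 := truncationConst_nonneg (ε := ε) hB0 hK0
  have A1 : B * (1 + 4 * ε ^ 2 + K) ≤ truncationConst B K ε := by unfold truncationConst; linarith
  have A2 : B * (1 + 4 * ε ^ 2) ≤ truncationConst B K ε := by unfold truncationConst; nlinarith
  have A3 : B ≤ truncationConst B K ε := by unfold truncationConst; nlinarith
  have A4 : K * B ^ 2 ≤ truncationConst B K ε := by unfold truncationConst; nlinarith
  have A5 : 4 * (B * (1 + 2 * ε ^ 2)) ^ 2 ≤ truncationConst B K ε := by
    unfold truncationConst; nlinarith
  have em : t + τ / 2 - τ / 2 = t := by ring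
  have ep : t + τ / 2 + τ / 2 = t + τ := by ring
  have hhalf : ∀ x y, |u (t + τ / 2) x y - u t x y| ≤ B * (τ / 2) := fun x y => by
    simpa using abs_sub_le_of_time hT hu hB ht (by linarith : t ≤ t + τ / 2) (by linarith) x y
  constructor
  · intro p
    rw [dLap_restrict (hu.periodic_x _ (mem _ (by linarith) (by linarith)))
      (hu.periodic_y _ (mem _ (by linarith) (by linarith))) hL]
    refine (abs_predictor_truncation_le hT hu hpde ha hf hua hB (half_pos hτ) ht (by linarith)
      hh _ _).trans ?_
    have : 0 ≤ h ^ 2 := sq_nonneg h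
    gcongr <;> linarith
  · intro p
    rw [dLap_half_add, dLap_restrict (hu.periodic_x _ (mem _ (by linarith) (by linarith)))
      (hu.periodic_y _ (mem _ (by linarith) (by linarith))) hL,
      dLap_restrict (hu.periodic_x _ (mem _ (by linarith) (by linarith)))
      (hu.periodic_y _ (mem _ (by linarith) (by linarith))) hL]
    have := abs_corrector_truncation_le hT hu hpde hB (half_pos hτ) (m := t + τ / 2) (by linarith)
      (by linarith) hh ((p.1.val : ℝ) * h) ((p.2.val : ℝ) * h)
    rw [em, ep, mul_div_cancel₀ τ two_ne_zero] at this
    refine this.trans ?_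
    gcongr
  · intro p
    refine (hf.abs_primitive_sub_add_le (hua t (mem t le_rfl (by linarith)) _ _)
      (hua _ (mem (t + τ / 2) (by linarith) (by linarith)) _ _)).trans ?_
    calc _ ≤ K * (B * (τ / 2)) ^ 2 := by
          have := hhalf ((p.1.val : ℝ) * h) ((p.2.val : ℝ) * h)
          gcongr
      _ = K * B ^ 2 * (τ ^ 2 / 4) := by ring
      _ ≤ truncationConst B K ε * τ ^ 2 := by
          gcongr
          nlinarith [sq_nonneg τ]
  · intro p
    have := abs_potential_truncation_le hT hu hpde hf hua hB (half_pos hτ) (m := t + τ / 2)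
      (by linarith) (by linarith) ((p.1.val : ℝ) * h) ((p.2.val : ℝ) * h)
    rw [em, ep] at this
    refine this.trans ?_
    calc 4 * (B * (1 + 2 * ε ^ 2)) ^ 2 * (τ / 2) ^ 3
        = 4 * (B * (1 + 2 * ε ^ 2)) ^ 2 * (τ ^ 3 / 8) := by ring
      _ ≤ truncationConst B K ε * τ ^ 3 := by
          gcongr
          have : 0 < τ ^ 3 := by positivity
          linarith
      _ = _ := by ring
  · intro p
    refine (hhalf _ _).trans ?_
    gcongr
    linarith
  · intro p
    have := abs_sub_le_of_time hT hu hB ht (by linarith : t ≤ t + τ) ht' ((p.1.val : ℝ) * h)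
      ((p.2.val : ℝ) * h)
    rw [add_sub_cancel_left] at this
    refine this.trans ?_
    gcongr
  · intro p
    have := abs_second_diff_le (w := fun r => u r ((p.1.val : ℝ) * h) ((p.2.val : ℝ) * h))
      (m := t + τ / 2) (half_pos hτ).le
      ((hu.continuousOn_time hT (l := []) (by simp) _ _).mono
        (Icc_subset_Icc (by linarith) (by linarith)))
      (fun r hr => hu.hasDerivAt_time hT (l := []) (by simp)
        ⟨by linarith [hr.1], by linarith [hr.2]⟩ _ _)
      (fun r hr => hu.hasDerivAt_time hT (l := [0]) (by simp)
        ⟨by linarith [hr.1], by linarith [hr.2]⟩ _ _)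
      (fun r hr => hB [0, 0] (by simp) r ⟨by linarith [hr.1], by linarith [hr.2]⟩ _ _)
    rw [em, ep] at this
    simp only [restrict]
    have h2 : |1 / 2 * (u (t + τ) ((p.1.val : ℝ) * h) ((p.2.val : ℝ) * h)
        + u t ((p.1.val : ℝ) * h) ((p.2.val : ℝ) * h))
        - u (t + τ / 2) ((p.1.val : ℝ) * h) ((p.2.val : ℝ) * h)| ≤ B * (τ / 2) ^ 2 := by
      rw [abs_le] at this ⊢
      constructor <;> linarith [this.1, this.2]
    refine h2.trans ?_
    gcongr
    linarith

/-! ### Quadrature error of the potential energy -/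

section Quadrature

variable {M : ℕ} {L h B : ℝ}

theorem sum_zmod_val [NeZero M] (φ : ℕ → ℝ) :
    ∑ i : ZMod M, φ i.val = ∑ i ∈ Finset.range M, φ i := by
  obtain ⟨m, rfl⟩ := Nat.exists_eq_succ_of_ne_zero (NeZero.ne M)
  exact Fin.sum_univ_eq_sum_range φ (m + 1)

/-- The rectangle rule has second order for periodic functions whose second differences are
`O(s²)`: averaging over cells to the right and to the left of the nodes turns the error into an
integral of second differences. -/
theorem abs_rectangle_sub_integral_le {g : ℝ → ℝ} (hg : Continuous g)
    (hper : Function.Periodic g L) (hL : L = M * h) (hh : 0 < h)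
    (hB : ∀ x s, 0 ≤ s → |g (x + s) + g (x - s) - 2 * g x| ≤ B * s ^ 2) :
    |h * ∑ i ∈ Finset.range M, g (i * h) - ∫ x in (0 : ℝ)..L, g x| ≤ L * B * h ^ 2 := by
  have hint : ∀ a b, IntervalIntegrable g MeasureTheory.volume a b := fun a b =>
    hg.intervalIntegrable a b
  have hB0 : 0 ≤ B := by
    have := (abs_nonneg _).trans (hB 0 1 zero_le_one)
    linarith
  have r1 : ∑ i ∈ Finset.range M, ∫ s in (0 : ℝ)..h, g (i * h + s) = ∫ x in (0 : ℝ)..L, g x := by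
    have := intervalIntegral.sum_integral_adjacent_intervals (f := g) (μ := MeasureTheory.volume)
      (a := fun k : ℕ => (k : ℝ) * h) (n := M) (fun k _ => hint _ _)
    rw [Nat.cast_zero, zero_mul, ← hL] at this
    rw [← this]
    refine Finset.sum_congr rfl fun i _ => ?_
    rw [intervalIntegral.integral_comp_add_left (fun x => g x) ((i : ℝ) * h)]
    push_cast; congr 1 <;> ring
  have r2 : ∑ i ∈ Finset.range M, ∫ s in (0 : ℝ)..h, g (i * h - s) = ∫ x in (0 : ℝ)..L, g x := by
    have := intervalIntegral.sum_integral_adjacent_intervals (f := g) (μ := MeasureTheory.volume)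
      (a := fun k : ℕ => (k : ℝ) * h - h) (n := M) (fun k _ => hint _ _)
    rw [Nat.cast_zero, zero_mul, ← hL, show L - h = (0 - h) + L by ring,
      hper.intervalIntegral_add_eq (0 - h) 0, zero_add] at this
    rw [← this]
    refine Finset.sum_congr rfl fun i _ => ?_
    rw [intervalIntegral.integral_comp_sub_left (fun x => g x) ((i : ℝ) * h)]
    push_cast; congr 1; ring
  have cell : ∀ i : ℕ, |(∫ s in (0 : ℝ)..h, g (i * h + s)) + (∫ s in (0 : ℝ)..h, g (i * h - s))
      - 2 * (h * g (i * h))| ≤ B * h ^ 2 * h := by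
    intro i
    have i1 : IntervalIntegrable (fun s => g (i * h + s)) MeasureTheory.volume 0 h :=
      (hg.comp (by fun_prop)).intervalIntegrable _ _
    have i2 : IntervalIntegrable (fun s => g (i * h - s)) MeasureTheory.volume 0 h :=
      (hg.comp (by fun_prop)).intervalIntegrable _ _
    have e : (∫ s in (0 : ℝ)..h, g (i * h + s)) + (∫ s in (0 : ℝ)..h, g (i * h - s))
        - 2 * (h * g (i * h))
        = ∫ s in (0 : ℝ)..h, (g (i * h + s) + g (i * h - s) - 2 * g (i * h)) := by
      rw [intervalIntegral.integral_sub (i1.add i2) (by simp), intervalIntegral.integral_add i1 i2,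
        intervalIntegral.integral_const]
      simp only [sub_zero, smul_eq_mul]
      ring
    rw [e]
    have := intervalIntegral.norm_integral_le_of_norm_le_const (a := 0) (b := h) (C := B * h ^ 2)
      (f := fun s => g (i * h + s) + g (i * h - s) - 2 * g (i * h)) (fun s hs => by
        rw [uIoc_of_le hh.le] at hs
        refine (hB _ s hs.1.le).trans ?_
        have := hs.2
        have := hs.1.le
        gcongr)
    simpa [abs_of_pos hh] using this
  have tot : 2 * ((∫ x in (0 : ℝ)..L, g x) - h * ∑ i ∈ Finset.range M, g (i * h))
      = ∑ i ∈ Finset.range M, ((∫ s in (0 : ℝ)..h, g (i * h + s))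
        + (∫ s in (0 : ℝ)..h, g (i * h - s)) - 2 * (h * g (i * h))) := by
    rw [Finset.sum_sub_distrib, Finset.sum_add_distrib, r1, r2, ← Finset.mul_sum,
      ← Finset.mul_sum]
    ring
  have bnd := (Finset.abs_sum_le_sum_abs (fun i : ℕ => (∫ s in (0 : ℝ)..h, g (i * h + s))
        + (∫ s in (0 : ℝ)..h, g (i * h - s)) - 2 * (h * g (i * h))) (Finset.range M)).trans
    (Finset.sum_le_sum fun i _ => cell i)
  rw [← tot, Finset.sum_const, Finset.card_range, nsmul_eq_mul, abs_mul, abs_two,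
    show (M : ℝ) * (B * h ^ 2 * h) = M * h * (B * h ^ 2) by ring, ← hL, abs_sub_comm] at bnd
  have hL0 : 0 ≤ L := by rw [hL]; positivity
  have : 0 ≤ L * (B * h ^ 2) := by positivity
  linarith

theorem abs_dInner_restrict_sub_integral_le [NeZero M] {G : ℝ → ℝ → ℝ}
    (hG : Continuous fun q : ℝ × ℝ => G q.1 q.2) (hx : ∀ x y, G (x + L) y = G x y)
    (hy : ∀ x y, G x (y + L) = G x y) (hL : L = M * h) (hh : 0 < h)
    (hBx : ∀ x y s, 0 ≤ s → |G (x + s) y + G (x - s) y - 2 * G x y| ≤ B * s ^ 2)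
    (hBy : ∀ x y s, 0 ≤ s → |G x (y + s) + G x (y - s) - 2 * G x y| ≤ B * s ^ 2) :
    |dInner h (restrict M h G) 1 - ∫ x in (0 : ℝ)..L, ∫ y in (0 : ℝ)..L, G x y|
      ≤ 2 * L ^ 2 * B * h ^ 2 := by
  have hL0 : 0 ≤ L := by rw [hL]; positivity
  have cy : ∀ x, Continuous (G x) := fun x => hG.comp (by fun_prop : Continuous fun y => (x, y))
  have cI : Continuous fun x => ∫ y in (0 : ℝ)..L, G x y :=
    intervalIntegral.continuous_parametric_intervalIntegral_of_continuous' hG 0 L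
  have e1 : dInner h (restrict M h G) 1
      = h * ∑ i ∈ Finset.range M, (h * ∑ j ∈ Finset.range M, G (i * h) (j * h)) := by
    simp only [dInner, restrict, Pi.one_apply, mul_one]
    rw [Fintype.sum_prod_type]
    rw [sum_zmod_val (fun i => ∑ j : ZMod M, G (i * h) (j.val * h)), ← Finset.mul_sum]
    simp_rw [fun i : ℕ => sum_zmod_val (M := M) (fun j => G (i * h) (j * h))]
    ring
  have k1 : ∀ i : ℕ, |h * ∑ j ∈ Finset.range M, G (i * h) (j * h) - ∫ y in (0 : ℝ)..L, G (i * h) y|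
      ≤ L * B * h ^ 2 := fun i =>
    abs_rectangle_sub_integral_le (cy _) (fun y => hy _ y) hL hh (fun y s hs => hBy _ y s hs)
  have k2 : |h * ∑ i ∈ Finset.range M, (∫ y in (0 : ℝ)..L, G (i * h) y)
      - ∫ x in (0 : ℝ)..L, ∫ y in (0 : ℝ)..L, G x y| ≤ L * (L * B) * h ^ 2 := by
    refine abs_rectangle_sub_integral_le cI (fun x => by simp only [hx]) hL hh ?_
    intro x s hs
    have i1 : ∀ x, IntervalIntegrable (G x) MeasureTheory.volume 0 L := fun x =>
      (cy x).intervalIntegrable _ _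
    rw [← intervalIntegral.integral_const_mul, ← intervalIntegral.integral_add (i1 _) (i1 _),
      ← intervalIntegral.integral_sub ((i1 _).add (i1 _)) ((i1 _).const_mul 2)]
    have := intervalIntegral.norm_integral_le_of_norm_le_const (a := 0) (b := L) (C := B * s ^ 2)
      (f := fun y => G (x + s) y + G (x - s) y - 2 * G x y) (fun y _ => hBx x y s hs)
    rw [sub_zero, abs_of_nonneg hL0] at this
    calc _ ≤ _ := this
      _ = _ := by ring
  have k3 : |h * ∑ i ∈ Finset.range M, (h * ∑ j ∈ Finset.range M, G (i * h) (j * h))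
      - h * ∑ i ∈ Finset.range M, (∫ y in (0 : ℝ)..L, G (i * h) y)| ≤ L * (L * B * h ^ 2) := by
    rw [← mul_sub, ← Finset.sum_sub_distrib, abs_mul, abs_of_pos hh]
    have := (Finset.abs_sum_le_sum_abs (fun i : ℕ => h * ∑ j ∈ Finset.range M, G (i * h) (j * h)
      - ∫ y in (0 : ℝ)..L, G (i * h) y) (Finset.range M)).trans (Finset.sum_le_sum fun i _ => k1 i)
    rw [Finset.sum_const, Finset.card_range, nsmul_eq_mul] at this
    refine (mul_le_mul_of_nonneg_left this hh.le).trans (le_of_eq ?_)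
    nth_rewrite 3 [hL]; ring
  rw [e1]
  refine (abs_sub_le _ _ _).trans ((add_le_add k3 k2).trans (le_of_eq ?_))
  ring

end Quadrature

theorem abs_dPotentialEnergy_restrict_sub_le {L T K a B : ℝ} {u : ℝ → ℝ → ℝ → ℝ} {f F : ℝ → ℝ}
    {M : ℕ} [NeZero M] {h : ℝ} (hT : 0 < T) (hu : IsSmoothPeriodic L T u) (ha : 0 ≤ a)
    (hf : IsTameOn K a f F) (hua : ∀ t ∈ Icc 0 T, ∀ x y, u t x y ∈ Icc (-a) a)
    (hB : ∀ l : List (Fin 3), l.length ≤ 4 → ∀ t ∈ Icc 0 T, ∀ x y, |partials T u l t x y| ≤ B)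
    (hL : L = M * h) (hh : 0 < h) {t : ℝ} (ht : t ∈ Icc 0 T) :
    |dPotentialEnergy h F (restrict M h (u t)) - potentialEnergy L F (u t)|
      ≤ 2 * L ^ 2 * (2 * K * B * (1 + B)) * h ^ 2 := by
  have hB0 : 0 ≤ B := (abs_nonneg _).trans (hB [] (by simp) 0 ⟨le_rfl, hT.le⟩ 0 0)
  have hK0 := hf.nonneg ha
  -- second differences of `F ∘ w` from first and second differences of `w`
  have comp : ∀ (w w₁ w₂ : ℝ → ℝ) (x s : ℝ), (∀ r, w r ∈ Icc (-a) a) →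
      (∀ r, HasDerivAt w (w₁ r) r) → (∀ r, HasDerivAt w₁ (w₂ r) r) →
      (∀ r, |w₁ r| ≤ B) → (∀ r, |w₂ r| ≤ B) → 0 ≤ s →
      |F (w (x + s)) + F (w (x - s)) - 2 * F (w x)| ≤ 2 * K * B * (1 + B) * s ^ 2 := by
    intro w w₁ w₂ x s hw h1 h2 b1 b2 hs
    have d1 := abs_sub_le_of_hasDerivAt (q := w) (a := x) (b := x + s) (by linarith)
      (fun r _ => (h1 r).continuousAt.continuousWithinAt) (fun r _ => h1 r) (fun r _ => b1 r)
    have d2 := abs_sub_le_of_hasDerivAt (q := w) (a := x - s) (b := x) (by linarith)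
      (fun r _ => (h1 r).continuousAt.continuousWithinAt) (fun r _ => h1 r) (fun r _ => b1 r)
    have d3 := abs_second_diff_le (w := w) (m := x) hs
      (fun r _ => (h1 r).continuousAt.continuousWithinAt) (fun r _ => h1 r) (fun r _ => h2 r)
      (fun r _ => b2 r)
    rw [add_sub_cancel_left] at d1
    rw [sub_sub_cancel, abs_sub_comm] at d2
    have c1 := (hf.abs_primitive_sub_add_le (hw x) (hw (x + s))).trans
      (mul_le_mul_of_nonneg_left (pow_le_pow_left₀ (abs_nonneg _) d1 2) hK0)
    have c2 := (hf.abs_primitive_sub_add_le (hw x) (hw (x - s))).trans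
      (mul_le_mul_of_nonneg_left (pow_le_pow_left₀ (abs_nonneg _) d2 2) hK0)
    have c3 : |f (w x) * (w (x + s) + w (x - s) - 2 * w x)| ≤ K * (2 * B * s ^ 2) := by
      rw [abs_mul]
      exact mul_le_mul (hf.bound _ (hw x)) d3 (abs_nonneg _) hK0
    rw [abs_le] at *
    constructor <;> nlinarith [c1.1, c1.2, c2.1, c2.2, c3.1, c3.2]
  have hcont : Continuous fun q : ℝ × ℝ => F (u t q.1 q.2) := by
    rw [continuous_iff_continuousAt]
    intro q
    exact ContinuousAt.comp (f := fun q : ℝ × ℝ => u t q.1 q.2)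
      (hf.hasDerivAt _ (hua t ht q.1 q.2)).continuousAt
      (hu.isPeriodicCn.continuous_space ht).continuousAt
  refine abs_dInner_restrict_sub_integral_le (G := fun x y => F (u t x y)) hcont
    (fun x y => by rw [hu.periodic_x t ht]) (fun x y => by rw [hu.periodic_y t ht]) hL hh ?_ ?_
  · intro x y s hs
    exact comp (fun x => u t x y) (fun x => partials T u [1] t x y)
      (fun x => partials T u [1, 1] t x y) x s (fun r => hua t ht r y)
      (fun r => hu.hasDerivAt_x hT (l := []) (by simp) ht r y)
      (fun r => hu.hasDerivAt_x hT (l := [1]) (by simp) ht r y)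
      (fun r => hB [1] (by simp) t ht r y) (fun r => hB [1, 1] (by simp) t ht r y) hs
  · intro x y s hs
    exact comp (fun y => u t x y) (fun y => partials T u [2] t x y)
      (fun y => partials T u [2, 2] t x y) y s (fun r => hua t ht x r)
      (fun r => hu.hasDerivAt_y hT (l := []) (by simp) ht x r)
      (fun r => hu.hasDerivAt_y hT (l := [2]) (by simp) ht x r)
      (fun r => hB [2] (by simp) t ht x r) (fun r => hB [2, 2] (by simp) t ht x r) hs

/-! ### The discrete inner product -/

section Linear

variable {M : ℕ} {h : ℝ}

theorem dGradX_sub (v w : GridFn M) : dGradX h (v - w) = dGradX h v - dGradX h w := by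
  funext p; simp only [dGradX, Pi.sub_apply]; ring

theorem dGradY_sub (v w : GridFn M) : dGradY h (v - w) = dGradY h v - dGradY h w := by
  funext p; simp only [dGradY, Pi.sub_apply]; ring

theorem dGradX_add (v w : GridFn M) : dGradX h (v + w) = dGradX h v + dGradX h w := by
  funext p; simp only [dGradX, Pi.add_apply]; ring

theorem dGradY_add (v w : GridFn M) : dGradY h (v + w) = dGradY h v + dGradY h w := by
  funext p; simp only [dGradY, Pi.add_apply]; ring

theorem dLap_sub (v w : GridFn M) : dLap h (v - w) = dLap h v - dLap h w := by
  funext p; simp only [dLap, Pi.sub_apply]; ring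

theorem dLap_smul (c : ℝ) (v : GridFn M) : dLap h (c • v) = c • dLap h v := by
  funext p; simp only [dLap, Pi.smul_apply, smul_eq_mul]; ring

end Linear

section Discrete

variable {M : ℕ} [NeZero M] {L h : ℝ}

theorem dInner_comm (v w : GridFn M) : dInner h v w = dInner h w v := by
  simp only [dInner, mul_comm]

theorem dInner_add_left (v v' w : GridFn M) :
    dInner h (v + v') w = dInner h v w + dInner h v' w := by
  simp only [dInner, Pi.add_apply, add_mul, Finset.sum_add_distrib, mul_add]

theorem dInner_smul_left (c : ℝ) (v w : GridFn M) : dInner h (c • v) w = c * dInner h v w := by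
  simp only [dInner, Pi.smul_apply, smul_eq_mul, mul_assoc, ← Finset.mul_sum]
  ring

theorem dInner_sub_left (v v' w : GridFn M) :
    dInner h (v - v') w = dInner h v w - dInner h v' w := by
  simp only [dInner, Pi.sub_apply, sub_mul, Finset.sum_sub_distrib, mul_sub]

theorem dInner_add_right (v w w' : GridFn M) :
    dInner h v (w + w') = dInner h v w + dInner h v w' := by
  rw [dInner_comm, dInner_add_left, dInner_comm w, dInner_comm w']

theorem dInner_sub_right (v w w' : GridFn M) :
    dInner h v (w - w') = dInner h v w - dInner h v w' := by
  rw [dInner_comm, dInner_sub_left, dInner_comm w, dInner_comm w']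

theorem dInner_smul_right (c : ℝ) (v w : GridFn M) : dInner h v (c • w) = c * dInner h v w := by
  rw [dInner_comm, dInner_smul_left, dInner_comm]

theorem dInner_self_nonneg (v : GridFn M) : 0 ≤ dInner h v v :=
  mul_nonneg (sq_nonneg h) (Finset.sum_nonneg fun _ _ => mul_self_nonneg _)

theorem dNorm_nonneg (v : GridFn M) : 0 ≤ dNorm h v := Real.sqrt_nonneg _

theorem dNorm_sq (v : GridFn M) : dNorm h v ^ 2 = dInner h v v :=
  Real.sq_sqrt (dInner_self_nonneg v)

theorem dNorm_eq_mul_norm (v : GridFn M) : dNorm h v = |h| * ‖WithLp.toLp 2 v‖ := by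
  rw [dNorm, dInner, Real.sqrt_mul (sq_nonneg h), Real.sqrt_sq_eq_abs, EuclideanSpace.norm_eq]
  congr 2
  refine Finset.sum_congr rfl fun p _ => ?_
  rw [Real.norm_eq_abs, sq_abs, sq]

theorem dNorm_add_le (v w : GridFn M) : dNorm h (v + w) ≤ dNorm h v + dNorm h w := by
  simp only [dNorm_eq_mul_norm, WithLp.toLp_add, ← mul_add]
  exact mul_le_mul_of_nonneg_left (norm_add_le _ _) (abs_nonneg h)

theorem dNorm_sub_le (v w : GridFn M) : dNorm h (v - w) ≤ dNorm h v + dNorm h w := by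
  simp only [dNorm_eq_mul_norm, WithLp.toLp_sub, ← mul_add]
  exact mul_le_mul_of_nonneg_left (norm_sub_le _ _) (abs_nonneg h)

theorem dNorm_smul (c : ℝ) (v : GridFn M) : dNorm h (c • v) = |c| * dNorm h v := by
  simp only [dNorm_eq_mul_norm, WithLp.toLp_smul, norm_smul, Real.norm_eq_abs]
  ring

theorem abs_dInner_le (v w : GridFn M) : |dInner h v w| ≤ dNorm h v * dNorm h w := by
  have e : dInner h v w = h ^ 2 * inner ℝ (WithLp.toLp 2 v) (WithLp.toLp 2 w) := by
    simp only [dInner, PiLp.inner_apply, RCLike.inner_apply, conj_trivial]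
    congr 1
    exact Finset.sum_congr rfl fun p _ => mul_comm _ _
  rw [e, abs_mul, abs_of_nonneg (sq_nonneg h), dNorm_eq_mul_norm, dNorm_eq_mul_norm]
  calc _ ≤ h ^ 2 * (‖WithLp.toLp 2 v‖ * ‖WithLp.toLp 2 w‖) :=
        mul_le_mul_of_nonneg_left (abs_real_inner_le_norm _ _) (sq_nonneg h)
    _ = _ := by rw [← sq_abs]; ring

theorem dNorm_le_mul_dNorm {c : ℝ} (hc : 0 ≤ c) {v w : GridFn M} (hvw : ∀ p, |v p| ≤ c * |w p|) :
    dNorm h v ≤ c * dNorm h w := by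
  refine (pow_le_pow_iff_left₀ (dNorm_nonneg v) (mul_nonneg hc (dNorm_nonneg w)) two_ne_zero).1 ?_
  rw [mul_pow, dNorm_sq, dNorm_sq]
  simp only [dInner]
  rw [mul_left_comm]
  refine mul_le_mul_of_nonneg_left ?_ (sq_nonneg h)
  rw [Finset.mul_sum]
  refine Finset.sum_le_sum fun p _ => ?_
  have := pow_le_pow_left₀ (abs_nonneg _) (hvw p) 2
  rw [mul_pow, sq_abs, sq_abs] at this
  linarith

theorem dNorm_one (hL : L = M * h) (hh : 0 < h) : dNorm h (1 : GridFn M) = L := by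
  have hL0 : 0 ≤ L := by rw [hL]; positivity
  rw [dNorm, Real.sqrt_eq_iff_mul_self_eq (dInner_self_nonneg _) hL0]
  simp only [dInner, Pi.one_apply, mul_one, Finset.sum_const, Finset.card_univ, Fintype.card_prod,
    ZMod.card, nsmul_eq_mul, Nat.cast_mul]
  rw [hL]; ring

theorem dNorm_le_of_abs_le (hL : L = M * h) (hh : 0 < h) {c : ℝ} {v : GridFn M}
    (hv : ∀ p, |v p| ≤ c) : dNorm h v ≤ L * c := by
  have hc : 0 ≤ c := (abs_nonneg _).trans (hv 0)
  have := dNorm_le_mul_dNorm (h := h) hc (v := v) (w := 1) (fun p => by simpa using hv p)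
  rw [dNorm_one hL hh] at this
  linarith

/-- Inverse inequality between the maximum norm and the discrete `L²` norm in two dimensions. -/
theorem abs_apply_le_dNorm_div (hh : 0 < h) (v : GridFn M) (p : ZMod M × ZMod M) :
    |v p| ≤ dNorm h v / h := by
  rw [le_div_iff₀ hh]
  refine (pow_le_pow_iff_left₀ (by positivity) (dNorm_nonneg v) two_ne_zero).1 ?_
  rw [dNorm_sq, mul_pow, sq_abs, mul_comm, dInner]
  refine mul_le_mul_of_nonneg_left ?_ (sq_nonneg h)
  rw [sq]
  exact Finset.single_le_sum (f := fun p => v p * v p) (fun _ _ => mul_self_nonneg _)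
    (Finset.mem_univ p)

/-- The discrete Dirichlet form. -/
noncomputable def dGradInner {M : ℕ} [NeZero M] (h : ℝ) (v w : GridFn M) : ℝ :=
  dInner h (dGradX h v) (dGradX h w) + dInner h (dGradY h v) (dGradY h w)

theorem dGradNorm_sq (v : GridFn M) : dGradNorm h v ^ 2 = dGradInner h v v :=
  Real.sq_sqrt (add_nonneg (dInner_self_nonneg _) (dInner_self_nonneg _))

theorem dGradInner_self_nonneg (v : GridFn M) : 0 ≤ dGradInner h v v :=
  add_nonneg (dInner_self_nonneg _) (dInner_self_nonneg _)

theorem dGradInner_add_sub (v w : GridFn M) :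
    dGradInner h (v + w) (v - w) = dGradInner h v v - dGradInner h w w := by
  simp only [dGradInner, dGradX_sub, dGradX_add, dGradY_sub, dGradY_add, dInner_add_left,
    dInner_sub_right, dInner_comm (dGradX h w) (dGradX h v),
    dInner_comm (dGradY h w) (dGradY h v)]
  ring

theorem dInner_add_sub (v w : GridFn M) :
    dInner h (v + w) (v - w) = dInner h v v - dInner h w w := by
  simp only [dInner_add_left, dInner_sub_right, dInner_comm w v]
  ring

/-- Summation by parts. -/
theorem dInner_dLap (v w : GridFn M) : dInner h (dLap h v) w = -dGradInner h v w := by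
  have shiftX : ∀ φ : ZMod M × ZMod M → ℝ, ∑ p : ZMod M × ZMod M, φ (p.1 + 1, p.2) = ∑ p, φ p :=
    fun φ => Fintype.sum_equiv ((Equiv.addRight (1 : ZMod M)).prodCongr (Equiv.refl _)) _ _
      fun p => rfl
  have shiftY : ∀ φ : ZMod M × ZMod M → ℝ, ∑ p : ZMod M × ZMod M, φ (p.1, p.2 + 1) = ∑ p, φ p :=
    fun φ => Fintype.sum_equiv ((Equiv.refl _).prodCongr (Equiv.addRight (1 : ZMod M))) _ _
      fun p => rfl
  have x1 := shiftX fun p => v p * w p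
  have x2 := shiftX fun p => v (p.1 - 1, p.2) * w p
  have y1 := shiftY fun p => v p * w p
  have y2 := shiftY fun p => v (p.1, p.2 - 1) * w p
  simp only [add_sub_cancel_right] at x2 y2
  have key : ∑ p : ZMod M × ZMod M, (dLap h v p * w p + (dGradX h v p * dGradX h w p
      + dGradY h v p * dGradY h w p)) = 0 := by
    have e : ∀ p : ZMod M × ZMod M, dLap h v p * w p + (dGradX h v p * dGradX h w p
        + dGradY h v p * dGradY h w p)
        = ((v (p.1 + 1, p.2) * w (p.1 + 1, p.2) - v p * w p)
          + (v (p.1, p.2 + 1) * w (p.1, p.2 + 1) - v p * w p)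
          - (v (p.1, p.2) * w (p.1 + 1, p.2) - v (p.1 - 1, p.2) * w p)
          - (v (p.1, p.2) * w (p.1, p.2 + 1) - v (p.1, p.2 - 1) * w p)) / h ^ 2 := by
      intro p
      simp only [dLap, dGradX, dGradY]
      ring
    simp_rw [e]
    rw [← Finset.sum_div]
    simp only [Finset.sum_sub_distrib, Finset.sum_add_distrib]
    rw [x1, y1, x2, y2]
    simp
  rw [Finset.sum_add_distrib, Finset.sum_add_distrib] at key
  simp only [dInner, dGradInner]
  rw [← mul_add, ← mul_neg]
  congr 1
  linarith

/-! ### Energy estimates for one implicit step -/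

/-- Testing an implicit Euler step with the new value. -/
theorem dNorm_le_of_implicit_step {ε μ σ : ℝ} (hμ : 0 ≤ μ) (hσ : 0 < σ) {e e' R : GridFn M}
    (he : e' - e = σ • (ε ^ 2 • dLap h e' + R - μ • (e' - e))) :
    dNorm h e' ≤ dNorm h e + σ * dNorm h R := by
  have h1 := congrArg (fun v => dInner h v e') he
  simp only [dInner_sub_left, dInner_add_left, dInner_smul_left, dInner_dLap] at h1
  have h2 := (abs_le.1 (abs_dInner_le (h := h) e e')).2
  have h3 := (abs_le.1 (abs_dInner_le (h := h) R e')).2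
  have h4 := mul_nonneg (sq_nonneg ε) (dGradInner_self_nonneg (h := h) e')
  rw [← dNorm_sq] at h1
  have nx := dNorm_nonneg (h := h) e'
  have ny := dNorm_nonneg (h := h) e
  have nr := dNorm_nonneg (h := h) R
  generalize dNorm h e' = x at *
  generalize dNorm h e = y at *
  generalize dNorm h R = r at *
  generalize dInner h e e' = i at *
  generalize dInner h R e' = j at *
  by_contra! hcon
  have hσr : 0 ≤ σ * r := by positivity
  have hx : 0 < x := by linarith
  have hσμ : 0 ≤ σ * μ := by positivity
  have a1 : (1 + σ * μ) * (x ^ 2 - i) ≤ σ * (r * x) := by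
    have := mul_le_mul_of_nonneg_left h3 hσ.le
    have := mul_nonneg hσ.le h4
    nlinarith
  have a2 : x * (x - y) ≤ x ^ 2 - i := by nlinarith
  have a3 : 0 < x * (x - y - σ * r) := mul_pos hx (by linarith)
  have a4 : 0 ≤ x ^ 2 - i := by nlinarith
  nlinarith [mul_nonneg hσμ a4]

/-- Testing a midpoint step with the average of the old and the new value. -/
theorem dNorm_le_of_midpoint_step {ε μ τ : ℝ} (hμ : 0 ≤ μ) (hτ : 0 < τ) {e e' N : GridFn M}
    (he : e' - e = τ • (ε ^ 2 • dLap h ((1 / 2 : ℝ) • (e' + e))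
      - μ • ((1 / 2 : ℝ) • (e' + e)) + N)) :
    dNorm h e' ≤ dNorm h e + τ * dNorm h N := by
  set m := (1 / 2 : ℝ) • (e' + e) with hm
  have h1 := congrArg (fun v => dInner h v m) he
  simp only [dInner_sub_left, dInner_add_left, dInner_smul_left, dInner_dLap] at h1
  have h0 : dInner h e' m - dInner h e m = 1 / 2 * (dNorm h e' ^ 2 - dNorm h e ^ 2) := by
    rw [← dInner_sub_left, hm, dInner_smul_right, dInner_comm, dInner_add_sub, dNorm_sq, dNorm_sq]
  rw [h0] at h1
  have h3 := (abs_le.1 (abs_dInner_le (h := h) N m)).2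
  have h4 := mul_nonneg (sq_nonneg ε) (dGradInner_self_nonneg (h := h) m)
  have h5 := mul_nonneg hμ (dInner_self_nonneg (h := h) m)
  have hmn : dNorm h m ≤ 1 / 2 * (dNorm h e' + dNorm h e) := by
    rw [hm, dNorm_smul, abs_of_pos (by norm_num : (0 : ℝ) < 1 / 2)]
    exact mul_le_mul_of_nonneg_left (dNorm_add_le _ _) (by norm_num)
  have nr := dNorm_nonneg (h := h) N
  have h6 := mul_le_mul_of_nonneg_left hmn nr
  have nx := dNorm_nonneg (h := h) e'
  have ny := dNorm_nonneg (h := h) e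
  generalize dNorm h e' = x at *
  generalize dNorm h e = y at *
  generalize dNorm h N = r at *
  by_contra! hcon
  have hτr : 0 ≤ τ * r := by positivity
  have a1 : x ^ 2 - y ^ 2 ≤ τ * r * (x + y) := by
    have := mul_le_mul_of_nonneg_left (h3.trans h6) hτ.le
    have := mul_nonneg hτ.le h4
    have := mul_nonneg hτ.le h5
    nlinarith
  have a3 : 0 < (x + y) * (x - y - τ * r) := mul_pos (by linarith) (by linarith)
  nlinarith

/-- Testing a midpoint step with the difference quotient `d` in time. -/
theorem dGradNorm_le_of_midpoint_step {ε τ : ℝ} (hτ : 0 < τ) {e e' d N : GridFn M}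
    (hd : d = τ⁻¹ • (e' - e)) (he : d = ε ^ 2 • dLap h ((1 / 2 : ℝ) • (e' + e)) + N) :
    τ * dNorm h d ^ 2 + ε ^ 2 * (dGradNorm h e' ^ 2 - dGradNorm h e ^ 2) ≤ τ * dNorm h N ^ 2 := by
  have h1 : dInner h d d = dInner h (ε ^ 2 • dLap h ((1 / 2 : ℝ) • (e' + e)) + N) d := by
    rw [← he]
  have h2 : dInner h (dLap h (e' + e)) d = -(τ⁻¹ * (dGradNorm h e' ^ 2 - dGradNorm h e ^ 2)) := by
    rw [hd, dInner_smul_right, dInner_dLap, dGradInner_add_sub, dGradNorm_sq, dGradNorm_sq]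
    ring
  rw [dInner_add_left, dInner_smul_left, dLap_smul, dInner_smul_left, h2, ← dNorm_sq] at h1
  have h3 := (abs_le.1 (abs_dInner_le (h := h) N d)).2
  generalize dGradNorm h e' ^ 2 - dGradNorm h e ^ 2 = G at *
  have h4 : τ * dNorm h d ^ 2 + ε ^ 2 * (1 / 2 * G) = τ * dInner h N d := by
    rw [h1]; field_simp; ring
  nlinarith [mul_nonneg hτ.le (sq_nonneg (dNorm h N - dNorm h d)),
    mul_le_mul_of_nonneg_left h3 hτ.le]

end Discrete

/-! ### Propagation of the error in one step -/

section Nonlinear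

variable {M : ℕ} [NeZero M] {L h K a : ℝ} {f F : ℝ → ℝ}

theorem dNorm_comp_le (hL : L = M * h) (hh : 0 < h) (hf : IsTameOn K a f F) {v : GridFn M}
    (hv : ∀ p, v p ∈ Icc (-a) a) : dNorm h (f ∘ v) ≤ L * K :=
  dNorm_le_of_abs_le hL hh fun p => hf.bound _ (hv p)

theorem abs_dPotentialEnergy_sub_le (hL : L = M * h) (hh : 0 < h) (ha : 0 ≤ a)
    (hf : IsTameOn K a f F) {v w : GridFn M} (hv : ∀ p, v p ∈ Icc (-a) a)
    (hw : ∀ p, w p ∈ Icc (-a) a) :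
    |dPotentialEnergy h F v - dPotentialEnergy h F w| ≤ K * L * dNorm h (v - w) := by
  rw [dPotentialEnergy, dPotentialEnergy, ← dInner_sub_left]
  refine (abs_dInner_le _ _).trans ?_
  rw [dNorm_one hL hh]
  have hL0 : 0 ≤ L := by rw [hL]; positivity
  have := dNorm_le_mul_dNorm (h := h) (hf.nonneg ha) (v := F ∘ v - F ∘ w) (w := v - w)
    (fun p => hf.abs_primitive_sub_le (hv p) (hw p))
  calc _ ≤ K * dNorm h (v - w) * L := mul_le_mul_of_nonneg_right this hL0
    _ = _ := by ring

/-- Stability constant of the nonlinear term. -/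
noncomputable def nonlinearConst (K L : ℝ) : ℝ := K + 2 * (K * L) * (K * L + 1)

theorem nonlinearConst_nonneg (hK : 0 ≤ K) (hL : 0 ≤ L) : 0 ≤ nonlinearConst K L := by
  unfold nonlinearConst; positivity

/-- If `s` is close to the potential energy of `w`, and `v` to `w`, then the coefficient `g(v,s)` is
close to `1`, and `g(v,s) f(v)` is close to `f(w)`. -/
theorem gCoef_estimates (hL : L = M * h) (hh : 0 < h) (ha : 0 ≤ a)
    (hf : IsTameOn K a f F) {v w : GridFn M} (hv : ∀ p, v p ∈ Icc (-a) a)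
    (hw : ∀ p, w p ∈ Icc (-a) a) {s b : ℝ} (hb1 : dNorm h (v - w) ≤ b)
    (hb2 : |s - dPotentialEnergy h F w| ≤ b) (hsmall : (K * L + 1) * b ≤ 1) :
    0 ≤ gCoef h F v s ∧ gCoef h F v s ≤ 3 ∧
      dNorm h (gCoef h F v s • (f ∘ v) - f ∘ w) ≤ nonlinearConst K L * b := by
  have hK := hf.nonneg ha
  have hL0 : 0 ≤ L := by rw [hL]; positivity
  have hKL : 0 ≤ K * L := mul_nonneg hK hL0
  have hE := (abs_dPotentialEnergy_sub_le hL hh ha hf hv hw).trans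
    (mul_le_mul_of_nonneg_left hb1 hKL)
  have hexp : |s - dPotentialEnergy h F v| ≤ (K * L + 1) * b := by
    rw [abs_le] at *
    constructor <;> linarith [hE.1, hE.2, hb2.1, hb2.2]
  have hg : |gCoef h F v s - 1| ≤ 2 * ((K * L + 1) * b) := by
    rw [gCoef, ← Real.exp_sub]
    exact (Real.abs_exp_sub_one_le (hexp.trans hsmall)).trans (by linarith)
  refine ⟨div_nonneg (Real.exp_pos _).le (Real.exp_pos _).le, by linarith [(abs_le.1 hg).2], ?_⟩
  have e : gCoef h F v s • (f ∘ v) - f ∘ w = (gCoef h F v s - 1) • (f ∘ v) + (f ∘ v - f ∘ w) := by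
    rw [sub_smul, one_smul]; abel
  have h1 : dNorm h (f ∘ v - f ∘ w) ≤ K * b :=
    (dNorm_le_mul_dNorm hK (w := v - w) fun p => hf.lipschitz _ (hv p) _ (hw p)).trans
      (mul_le_mul_of_nonneg_left hb1 hK)
  have h2 : dNorm h ((gCoef h F v s - 1) • (f ∘ v)) ≤ 2 * ((K * L + 1) * b) * (L * K) := by
    rw [dNorm_smul]
    exact mul_le_mul hg (dNorm_comp_le hL hh hf hv) (dNorm_nonneg _) ((abs_nonneg _).trans hg)
  rw [e]
  refine (dNorm_add_le _ _).trans ((add_le_add h2 h1).trans (le_of_eq ?_))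
  unfold nonlinearConst; ring

end Nonlinear

/-- One step `(u₀, s₀) ↦ (uh, sh) ↦ (u₁, s₁)` of the scheme, next to mesh functions `U₀`, `Um`, `U₁`
that satisfy the scheme up to truncation errors. -/
structure IsStep {M : ℕ} [NeZero M] (L h τ ε κ K a A : ℝ) (f F : ℝ → ℝ)
    (U₀ Um U₁ u₀ uh u₁ : GridFn M) (s₀ sh s₁ : ℝ) : Prop where
  length : L = M * h
  mesh_pos : 0 < h
  time_pos : 0 < τ
  time_le : τ ≤ 1
  radius_nonneg : 0 ≤ a
  tame : IsTameOn K a f F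
  consistent : IsConsistent A h τ ε f F U₀ Um U₁
  mem_start : ∀ p, U₀ p ∈ Icc (-a) a
  mem_half : ∀ p, Um p ∈ Icc (-a) a
  predictor_u : (τ / 2)⁻¹ • (uh - u₀)
      = ε ^ 2 • dLap h uh + gCoef h F u₀ s₀ • (f ∘ u₀) - (κ * gCoef h F u₀ s₀) • (uh - u₀)
  predictor_s : sh - s₀ = - gCoef h F u₀ s₀ * dInner h (f ∘ u₀) (uh - u₀)
  corrector_u : τ⁻¹ • (u₁ - u₀)
      = ε ^ 2 • dLap h ((1 / 2 : ℝ) • (u₁ + u₀)) + gCoef h F uh sh • (f ∘ uh)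
        - (κ * gCoef h F uh sh) • ((1 / 2 : ℝ) • (u₁ + u₀) - uh)
  corrector_s : (s₁ - s₀) / τ
      = - gCoef h F uh sh * dInner h (f ∘ uh) (τ⁻¹ • (u₁ - u₀))
        + κ * gCoef h F uh sh * dInner h ((1 / 2 : ℝ) • (u₁ + u₀) - uh) (τ⁻¹ • (u₁ - u₀))

set_option maxHeartbeats 400000 in
/-- The predictor has local error `O(τ²)`, which does not spoil second-order accuracy since it only
enters the corrector through the right-hand side. -/
theorem exists_predictor_const {L κ K A : ℝ} (hL0 : 0 ≤ L) (hκ : 0 ≤ κ) (hK : 0 ≤ K) (hA : 0 ≤ A) :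
    ∃ C : ℝ, 1 ≤ C ∧ ∀ (M : ℕ) [NeZero M] (h τ ε a b : ℝ) (f F : ℝ → ℝ)
      (U₀ Um U₁ u₀ uh u₁ : GridFn M) (s₀ sh s₁ : ℝ),
      IsStep L h τ ε κ K a A f F U₀ Um U₁ u₀ uh u₁ s₀ sh s₁ → (∀ p, u₀ p ∈ Icc (-a) a) →
      dNorm h (u₀ - U₀) ≤ b → |s₀ - dPotentialEnergy h F U₀| ≤ b → τ ^ 2 + h ^ 2 ≤ b →
      (K * L + 1) * b ≤ 1 →
      dNorm h (uh - Um) ≤ C * b ∧ |sh - dPotentialEnergy h F Um| ≤ C * b := by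
  set A1 := nonlinearConst K L with hA1
  have hA10 : 0 ≤ A1 := nonlinearConst_nonneg hK hL0
  set A2 := 1 + A1 + 3 * κ * (L * A) + 2 * (L * A) with hA2
  have hA20 : 0 ≤ A2 := by positivity
  set A3 := 1 + 3 * (L * K) * (A2 + 1) + A1 * (L * A) + L ^ 2 * A with hA3
  have hA30 : 0 ≤ A3 := by positivity
  refine ⟨1 + A2 + A3, by linarith, ?_⟩
  intro M _ h τ ε a b f F U₀ Um U₁ u₀ uh u₁ s₀ sh s₁ st hu₀ hb1 hb2 hb3 hsmall
  have hb0 : 0 ≤ b := (dNorm_nonneg _).trans hb1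
  have hh := st.mesh_pos
  have hL := st.length
  have hτ := st.time_pos
  have hτ1 := st.time_le
  obtain ⟨g0, g3, hN0⟩ := gCoef_estimates hL hh st.radius_nonneg st.tame hu₀ st.mem_start hb1 hb2
    hsmall
  have hPu := st.predictor_u
  have hPs := st.predictor_s
  set g := gCoef h F u₀ s₀ with hg
  set N0 := g • (f ∘ u₀) - f ∘ U₀ with hN0def
  set r0 := (τ / 2)⁻¹ • (Um - U₀) - ε ^ 2 • dLap h Um - f ∘ U₀ with hr0
  have hr0b : dNorm h r0 ≤ L * (2 * (A * (τ + h ^ 2))) := by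
    refine dNorm_le_of_abs_le hL hh fun p => ?_
    have := st.consistent.predictor p
    have e : r0 p = (τ / 2)⁻¹ * (Um p - U₀ p - τ / 2 * (ε ^ 2 * dLap h Um p + f (U₀ p))) := by
      simp only [hr0, Pi.sub_apply, Pi.smul_apply, smul_eq_mul, Function.comp_apply]
      field_simp
      ring
    rw [e, abs_mul, abs_of_pos (by positivity : 0 < (τ / 2)⁻¹), inv_mul_le_iff₀ (by positivity)]
    linarith
  have hhalf : dNorm h (Um - U₀) ≤ L * (A * τ) :=
    dNorm_le_of_abs_le hL hh st.consistent.half_step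
  have hgk : 0 ≤ κ * g := mul_nonneg hκ g0
  set R := N0 - (κ * g) • (Um - U₀) - r0 with hR
  have hRb : dNorm h R ≤ A1 * b + 3 * κ * (L * (A * τ)) + L * (2 * (A * (τ + h ^ 2))) := by
    refine (dNorm_sub_le _ _).trans (add_le_add ((dNorm_sub_le _ _).trans (add_le_add hN0 ?_)) hr0b)
    rw [dNorm_smul, abs_of_nonneg hgk]
    have : κ * g ≤ 3 * κ := by rw [mul_comm 3]; exact mul_le_mul_of_nonneg_left g3 hκ
    exact mul_le_mul this hhalf (dNorm_nonneg _) (by positivity)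
  have herr : (uh - Um) - (u₀ - U₀)
      = (τ / 2) • (ε ^ 2 • dLap h (uh - Um) + R - (κ * g) • ((uh - Um) - (u₀ - U₀))) := by
    have e1 : uh - u₀ = (τ / 2) • (ε ^ 2 • dLap h uh + g • (f ∘ u₀) - (κ * g) • (uh - u₀)) := by
      rw [← hPu, smul_inv_smul₀ (by positivity)]
    have e2 : Um - U₀ = (τ / 2) • (ε ^ 2 • dLap h Um + f ∘ U₀ + r0) := by
      have : ε ^ 2 • dLap h Um + f ∘ U₀ + r0 = (τ / 2)⁻¹ • (Um - U₀) := by rw [hr0]; abel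
      rw [this, smul_inv_smul₀ (by positivity)]
    funext p
    have p1 := congrFun e1 p
    have p2 := congrFun e2 p
    simp only [hR, hN0def, dLap_sub, Pi.sub_apply, Pi.add_apply, Pi.smul_apply, smul_eq_mul,
      Function.comp_apply] at p1 p2 ⊢
    linear_combination p1 - p2
  have hstep := dNorm_le_of_implicit_step hgk (half_pos hτ) herr
  have ρ1 : τ * τ ≤ b := by
    rw [← sq]; exact (le_add_of_nonneg_right (sq_nonneg h)).trans hb3
  have ρ2 : τ * (τ + h ^ 2) ≤ b := by
    rw [mul_add, ← sq]
    exact (add_le_add le_rfl (mul_le_of_le_one_left (sq_nonneg h) hτ1)).trans hb3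
  have hû : dNorm h (uh - Um) ≤ A2 * b := by
    have t1 := mul_le_mul_of_nonneg_left hRb (half_pos hτ).le
    have t2 : τ * (A1 * b) ≤ A1 * b := mul_le_of_le_one_left (by positivity) hτ1
    have t3 : 3 * κ * (L * A) * (τ * τ) ≤ 3 * κ * (L * A) * b :=
      mul_le_mul_of_nonneg_left ρ1 (by positivity)
    have t4 : L * A * (τ * (τ + h ^ 2)) ≤ L * A * b := mul_le_mul_of_nonneg_left ρ2 (by positivity)
    have t5 : 0 ≤ A1 * b := by positivity
    have t6 : 0 ≤ 3 * κ * (L * A) * b := by positivity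
    have t7 : 0 ≤ L * A * b := by positivity
    rw [hA2]
    linarith
  have hŝ : |sh - dPotentialEnergy h F Um| ≤ A3 * b := by
    set q0 : GridFn M := F ∘ Um - F ∘ U₀ + (f ∘ U₀) * (Um - U₀) with hq0
    have hq0b : |dInner h q0 1| ≤ L * (A * τ ^ 2) * L := by
      refine (abs_dInner_le _ _).trans ?_
      rw [dNorm_one hL hh]
      exact mul_le_mul_of_nonneg_right (dNorm_le_of_abs_le hL hh fun p =>
        st.consistent.potential_predictor p) hL0
    have eE : dPotentialEnergy h F Um - dPotentialEnergy h F U₀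
        = dInner h q0 1 - dInner h (f ∘ U₀) (Um - U₀) := by
      rw [dPotentialEnergy, dPotentialEnergy, ← dInner_sub_left, hq0, dInner_add_left]
      have : dInner h ((f ∘ U₀) * (Um - U₀)) 1 = dInner h (f ∘ U₀) (Um - U₀) := by
        simp [dInner]
      rw [this]; ring
    have e : sh - dPotentialEnergy h F Um = (s₀ - dPotentialEnergy h F U₀)
        - g * dInner h (f ∘ u₀) ((uh - Um) - (u₀ - U₀)) - dInner h N0 (Um - U₀)
        - dInner h q0 1 := by
      have x1 : dInner h (f ∘ u₀) ((uh - Um) - (u₀ - U₀))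
          = dInner h (f ∘ u₀) (uh - u₀) - dInner h (f ∘ u₀) (Um - U₀) := by
        rw [← dInner_sub_right]; congr 1; abel
      have x2 : dInner h N0 (Um - U₀)
          = g * dInner h (f ∘ u₀) (Um - U₀) - dInner h (f ∘ U₀) (Um - U₀) := by
        rw [hN0def, dInner_sub_left, dInner_smul_left]
      rw [x1, x2]
      linear_combination hPs - eE
    have b1 : |g * dInner h (f ∘ u₀) ((uh - Um) - (u₀ - U₀))| ≤ 3 * (L * K * (A2 * b + b)) := by
      rw [abs_mul, abs_of_nonneg g0]
      refine mul_le_mul g3 ((abs_dInner_le _ _).trans (mul_le_mul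
        (dNorm_comp_le hL hh st.tame hu₀) ((dNorm_sub_le _ _).trans (add_le_add hû hb1))
        (dNorm_nonneg _) (by positivity))) (abs_nonneg _) (by norm_num)
    have b2 : |dInner h N0 (Um - U₀)| ≤ A1 * b * (L * (A * 1)) := by
      refine (abs_dInner_le _ _).trans (mul_le_mul hN0 (hhalf.trans ?_) (dNorm_nonneg _)
        (by positivity))
      gcongr
    have b3 : L * (A * τ ^ 2) * L ≤ L ^ 2 * A * b := by
      have := mul_le_mul_of_nonneg_left ρ1 (by positivity : 0 ≤ L ^ 2 * A)
      linarith
    rw [e]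
    refine (abs_sub _ _).trans ((add_le_add ((abs_sub _ _).trans (add_le_add
      ((abs_sub _ _).trans (add_le_add hb2 b1)) b2)) (hq0b.trans b3)).trans (le_of_eq ?_))
    rw [hA3]; ring
  constructor
  · refine hû.trans (mul_le_mul_of_nonneg_right ?_ hb0); linarith
  · refine hŝ.trans (mul_le_mul_of_nonneg_right ?_ hb0); linarith

set_option maxHeartbeats 400000 in
/-- Energy estimates for the corrector; `D` is the norm of the difference quotient of the error in
time. -/
theorem exists_corrector_const {L κ K A C₀ : ℝ} (hL0 : 0 ≤ L) (hκ : 0 ≤ κ) (hK : 0 ≤ K)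
    (hA : 0 ≤ A) (hC₀ : 1 ≤ C₀) :
    ∃ C : ℝ, 0 ≤ C ∧ ∀ (M : ℕ) [NeZero M] (h τ ε a b : ℝ) (f F : ℝ → ℝ)
      (U₀ Um U₁ u₀ uh u₁ : GridFn M) (s₀ sh s₁ : ℝ),
      IsStep L h τ ε κ K a A f F U₀ Um U₁ u₀ uh u₁ s₀ sh s₁ → (∀ p, uh p ∈ Icc (-a) a) →
      dNorm h (u₀ - U₀) ≤ b → τ ^ 2 + h ^ 2 ≤ b → b ≤ 1 →
      dNorm h (uh - Um) ≤ C₀ * b → |sh - dPotentialEnergy h F Um| ≤ C₀ * b →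
      (K * L + 1) * (C₀ * b) ≤ 1 →
      ∃ D : ℝ, 0 ≤ D ∧ dNorm h (u₁ - U₁) ≤ dNorm h (u₀ - U₀) + τ * (C * b) ∧
        τ * D ^ 2 + ε ^ 2 * (dGradNorm h (u₁ - U₁) ^ 2 - dGradNorm h (u₀ - U₀) ^ 2)
          ≤ τ * (C * b) ^ 2 ∧
        |s₁ - dPotentialEnergy h F U₁| ≤ |s₀ - dPotentialEnergy h F U₀| + τ * (C * D + C * b) := by
  have hC0' : 0 ≤ C₀ := by linarith
  set A1 := nonlinearConst K L with hA1
  have hA10 : 0 ≤ A1 := nonlinearConst_nonneg hK hL0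
  set A5 := A1 * C₀ + 3 * κ * (L * A) + 3 * κ * C₀ + L * A with hA5
  have hA50 : 0 ≤ A5 := by positivity
  set A6 := A5 + 3 * κ * (1 + A5) with hA6
  have hA60 : 0 ≤ A6 := by positivity
  set A7 := 1 + A5 + L * A + C₀ with hA7
  have hA70 : 0 ≤ A7 := by positivity
  set A8 := 3 * (L * K) + 3 * κ * A7 with hA8
  have hA80 : 0 ≤ A8 := by positivity
  set A9 := A1 * C₀ * (L * A) + 3 * κ * A7 * (L * A) + L ^ 2 * A with hA9
  have hA90 : 0 ≤ A9 := by positivity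
  refine ⟨A5 + A6 + A8 + A9, by positivity, ?_⟩
  intro M _ h τ ε a b f F U₀ Um U₁ u₀ uh u₁ s₀ sh s₁ st huh hb1 hb3 hbone hc1 hc2 hsmall
  have hb0 : 0 ≤ b := (dNorm_nonneg _).trans hb1
  have hh := st.mesh_pos
  have hL := st.length
  have hτ := st.time_pos
  have hτ1 := st.time_le
  obtain ⟨g0, g3, hN1⟩ := gCoef_estimates hL hh st.radius_nonneg st.tame huh st.mem_half hc1 hc2
    hsmall
  have hCu := st.corrector_u
  have hCs := st.corrector_s
  set g := gCoef h F uh sh with hg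
  set N1 := g • (f ∘ uh) - f ∘ Um with hN1def
  have hgk : 0 ≤ κ * g := mul_nonneg hκ g0
  have hgk3 : κ * g ≤ 3 * κ := by rw [mul_comm 3]; exact mul_le_mul_of_nonneg_left g3 hκ
  have hτ2 : τ ^ 2 ≤ b := (le_add_of_nonneg_right (sq_nonneg h)).trans hb3
  set r1 := τ⁻¹ • (U₁ - U₀) - ε ^ 2 • dLap h ((1 / 2 : ℝ) • (U₁ + U₀)) - f ∘ Um with hr1
  have hr1b : dNorm h r1 ≤ L * A * b := by
    rw [mul_assoc]
    refine dNorm_le_of_abs_le hL hh fun p => ?_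
    have := st.consistent.corrector p
    have e : r1 p = τ⁻¹ * (U₁ p - U₀ p
        - τ * (ε ^ 2 * dLap h ((1 / 2 : ℝ) • (U₁ + U₀)) p + f (Um p))) := by
      simp only [hr1, Pi.sub_apply, Pi.smul_apply, smul_eq_mul, Function.comp_apply]
      field_simp
      ring
    rw [e, abs_mul, abs_of_pos (by positivity : 0 < τ⁻¹), inv_mul_le_iff₀ hτ]
    exact this.trans (by gcongr)
  set zU := (1 / 2 : ℝ) • (U₁ + U₀) - Um with hzU
  have hzUb : dNorm h zU ≤ L * A * b := by
    rw [mul_assoc]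
    refine dNorm_le_of_abs_le hL hh fun p => ?_
    exact (st.consistent.average p).trans (by gcongr)
  set m := (1 / 2 : ℝ) • ((u₁ - U₁) + (u₀ - U₀)) with hm
  set N := N1 + (κ * g) • ((uh - Um) - zU) - r1 with hN
  have hNb : dNorm h N ≤ A5 * b := by
    have x1 : dNorm h ((κ * g) • ((uh - Um) - zU)) ≤ 3 * κ * (C₀ * b + L * A * b) := by
      rw [dNorm_smul, abs_of_nonneg hgk]
      exact mul_le_mul hgk3 ((dNorm_sub_le _ _).trans (add_le_add hc1 hzUb)) (dNorm_nonneg _)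
        (by positivity)
    refine (dNorm_sub_le _ _).trans ((add_le_add ((dNorm_add_le _ _).trans (add_le_add hN1 x1))
      hr1b).trans (le_of_eq ?_))
    rw [hA5]; ring
  set d := τ⁻¹ • ((u₁ - U₁) - (u₀ - U₀)) with hd
  have herr : d = ε ^ 2 • dLap h m - (κ * g) • m + N := by
    funext p
    have p1 := congrFun hCu p
    simp only [hd, hN, hm, hzU, hr1, hN1def, dLap_smul, Pi.sub_apply, Pi.add_apply,
      Pi.smul_apply, smul_eq_mul, Function.comp_apply] at p1 ⊢
    have e1 : dLap h (u₁ + u₀) p = dLap h u₁ p + dLap h u₀ p := by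
      simp only [dLap, Pi.add_apply]; ring
    have e2 : dLap h (U₁ + U₀) p = dLap h U₁ p + dLap h U₀ p := by
      simp only [dLap, Pi.add_apply]; ring
    have e3 : dLap h (u₁ - U₁ + (u₀ - U₀)) p
        = dLap h u₁ p - dLap h U₁ p + (dLap h u₀ p - dLap h U₀ p) := by
      simp only [dLap, Pi.add_apply, Pi.sub_apply]; ring
    rw [e1] at p1
    rw [e2, e3]
    linear_combination p1
  have hde : (u₁ - U₁) - (u₀ - U₀) = τ • d := by rw [hd, smul_inv_smul₀ hτ.ne']
  have hstep1 : dNorm h (u₁ - U₁) ≤ dNorm h (u₀ - U₀) + τ * dNorm h N :=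
    dNorm_le_of_midpoint_step hgk hτ (by rw [hde, herr])
  have hstep1' : dNorm h (u₁ - U₁) ≤ dNorm h (u₀ - U₀) + τ * (A5 * b) :=
    hstep1.trans (by gcongr)
  have hmb : dNorm h m ≤ (1 + A5) * b := by
    have x1 := dNorm_add_le (h := h) (u₁ - U₁) (u₀ - U₀)
    rw [hm, dNorm_smul, abs_of_pos (by norm_num : (0 : ℝ) < 1 / 2)]
    have : τ * (A5 * b) ≤ 1 * (A5 * b) := mul_le_mul_of_nonneg_right hτ1 (by positivity)
    have : 0 ≤ A5 * b := by positivity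
    linarith
  have hN2b : dNorm h (N - (κ * g) • m) ≤ A6 * b := by
    have x1 : dNorm h ((κ * g) • m) ≤ 3 * κ * ((1 + A5) * b) := by
      rw [dNorm_smul, abs_of_nonneg hgk]
      exact mul_le_mul hgk3 hmb (dNorm_nonneg _) (by positivity)
    refine (dNorm_sub_le _ _).trans ((add_le_add hNb x1).trans (le_of_eq ?_))
    rw [hA6]; ring
  have hstep2 := dGradNorm_le_of_midpoint_step (ε := ε) (h := h) (N := N - (κ * g) • m) hτ hd
    (by rw [herr]; abel)
  have hstep2' := hstep2.trans (mul_le_mul_of_nonneg_left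
    (pow_le_pow_left₀ (dNorm_nonneg _) hN2b 2) hτ.le)
  -- the auxiliary variable
  set D := dNorm h d with hD
  have hD0 : 0 ≤ D := dNorm_nonneg _
  set dU := τ⁻¹ • (U₁ - U₀) with hdU
  have hdUb : dNorm h dU ≤ L * A := by
    refine dNorm_le_of_abs_le hL hh fun p => ?_
    simp only [hdU, Pi.smul_apply, Pi.sub_apply, smul_eq_mul]
    rw [abs_mul, abs_of_pos (by positivity : 0 < τ⁻¹), inv_mul_le_iff₀ hτ]
    linarith [st.consistent.full_step p]
  have hdu : τ⁻¹ • (u₁ - u₀) = d + dU := by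
    rw [hd, hdU, ← smul_add]; congr 1; abel
  set z := (1 / 2 : ℝ) • (u₁ + u₀) - uh with hz
  have hzb : dNorm h z ≤ A7 * b := by
    have e : z = m + zU - (uh - Um) := by
      funext p
      simp only [hz, hm, hzU, Pi.sub_apply, Pi.add_apply, Pi.smul_apply, smul_eq_mul]
      ring
    rw [e]
    refine (dNorm_sub_le _ _).trans ((add_le_add ((dNorm_add_le _ _).trans (add_le_add hmb hzUb))
      hc1).trans (le_of_eq ?_))
    rw [hA7]; ring
  set q1 : GridFn M := F ∘ U₁ - F ∘ U₀ + (f ∘ Um) * (U₁ - U₀) with hq1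
  have hq1b : |dInner h q1 1| ≤ τ * (L ^ 2 * A * b) := by
    refine (abs_dInner_le _ _).trans ?_
    rw [dNorm_one hL hh]
    refine (mul_le_mul_of_nonneg_right (dNorm_le_of_abs_le hL hh fun p =>
      st.consistent.potential_corrector p) hL0).trans ?_
    have := mul_le_mul_of_nonneg_left hτ2 (by positivity : 0 ≤ τ * (L ^ 2 * A))
    linarith
  have eE : dPotentialEnergy h F U₁ - dPotentialEnergy h F U₀
      = dInner h q1 1 - τ * dInner h (f ∘ Um) dU := by
    rw [dPotentialEnergy, dPotentialEnergy, ← dInner_sub_left, hq1, dInner_add_left, hdU,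
      dInner_smul_right, mul_inv_cancel_left₀ hτ.ne']
    have : dInner h ((f ∘ Um) * (U₁ - U₀)) 1 = dInner h (f ∘ Um) (U₁ - U₀) := by
      simp [dInner]
    rw [this]; ring
  have eS : s₁ - dPotentialEnergy h F U₁ = (s₀ - dPotentialEnergy h F U₀)
      + τ * (-(g * dInner h (f ∘ uh) d) - dInner h N1 dU + κ * g * dInner h z (d + dU))
      - dInner h q1 1 := by
    rw [hdu, div_eq_iff hτ.ne', dInner_add_right (f ∘ uh)] at hCs
    have x2 : dInner h N1 dU = g * dInner h (f ∘ uh) dU - dInner h (f ∘ Um) dU := by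
      rw [hN1def, dInner_sub_left, dInner_smul_left]
    rw [x2]
    linear_combination hCs - eE
  have b1 : |g * dInner h (f ∘ uh) d| ≤ 3 * (L * K * D) := by
    rw [abs_mul, abs_of_nonneg g0]
    exact mul_le_mul g3 ((abs_dInner_le _ _).trans (mul_le_mul_of_nonneg_right
      (dNorm_comp_le hL hh st.tame huh) hD0)) (abs_nonneg _) (by norm_num)
  have b2 : |dInner h N1 dU| ≤ A1 * (C₀ * b) * (L * A) :=
    (abs_dInner_le _ _).trans (mul_le_mul hN1 hdUb (dNorm_nonneg _) (by positivity))
  have b3 : |κ * g * dInner h z (d + dU)| ≤ 3 * κ * (A7 * b * (D + L * A)) := by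
    rw [abs_mul, abs_of_nonneg hgk]
    exact mul_le_mul hgk3 ((abs_dInner_le _ _).trans (mul_le_mul hzb ((dNorm_add_le _ _).trans
      (add_le_add le_rfl hdUb)) (dNorm_nonneg _) (by positivity))) (abs_nonneg _) (by positivity)
  have hstep3 : |s₁ - dPotentialEnergy h F U₁|
      ≤ |s₀ - dPotentialEnergy h F U₀| + τ * (A8 * D + A9 * b) := by
    rw [eS]
    refine (abs_sub _ _).trans ?_
    have x1 : |(s₀ - dPotentialEnergy h F U₀)
        + τ * (-(g * dInner h (f ∘ uh) d) - dInner h N1 dU + κ * g * dInner h z (d + dU))|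
        ≤ |s₀ - dPotentialEnergy h F U₀| + τ * (3 * (L * K * D) + A1 * (C₀ * b) * (L * A)
          + 3 * κ * (A7 * b * (D + L * A))) := by
      refine (abs_add_le _ _).trans (add_le_add le_rfl ?_)
      rw [abs_mul, abs_of_pos hτ]
      refine mul_le_mul_of_nonneg_left ((abs_add_le _ _).trans (add_le_add
        ((abs_sub _ _).trans (add_le_add ?_ b2)) b3)) hτ.le
      rwa [abs_neg]
    have x2 : 3 * κ * A7 * D * b ≤ 3 * κ * A7 * D * 1 :=
      mul_le_mul_of_nonneg_left hbone (by positivity)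
    refine (add_le_add x1 hq1b).trans ?_
    rw [add_assoc, ← mul_add]
    refine add_le_add le_rfl (mul_le_mul_of_nonneg_left ?_ hτ.le)
    rw [hA8, hA9]
    linarith
  have p5 : 0 ≤ A5 * b := by positivity
  refine ⟨D, hD0, hstep1'.trans ?_, hstep2'.trans ?_, hstep3.trans ?_⟩
  · gcongr; linarith
  · gcongr; linarith
  · gcongr
    · linarith
    · linarith

/-- The three estimates of the corrector combine to a discrete Gronwall inequality for
`Y = x² + ε² G² + σ²`: the term `τ D²` produced by the gradient estimate absorbs the difference
quotient in the estimate of the auxiliary variable. -/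
theorem sq_step_le {C τ E ρ x x' G G' σ σ' D b : ℝ} (hC : 0 ≤ C) (hτ : 0 < τ) (hτ1 : τ ≤ 1)
    (hτC : 4 * C ^ 2 * τ ≤ 1) (hx : 0 ≤ x) (hx' : 0 ≤ x') (hσ : 0 ≤ σ) (hσ' : 0 ≤ σ')
    (hρ : 0 ≤ ρ) (hD : 0 ≤ D) (hb : b = x + σ + ρ) (h1 : x' ≤ x + τ * (C * b))
    (h2 : τ * D ^ 2 + E * (G' - G) ≤ τ * (C * b) ^ 2) (h3 : σ' ≤ σ + τ * (C * D + C * b))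
    (hG : 0 ≤ E * G) :
    x' ^ 2 + E * G' + σ' ^ 2 ≤ x ^ 2 + E * G + σ ^ 2
      + τ * (12 * (C + 2 * C ^ 2) * (x ^ 2 + E * G + σ ^ 2 + ρ ^ 2)) := by
  have hb0 : 0 ≤ b := by rw [hb]; positivity
  have hCb : 0 ≤ C * b := by positivity
  have bx : x ≤ b := by rw [hb]; linarith
  have bσ : σ ≤ b := by rw [hb]; linarith
  have a1 : x' ^ 2 ≤ x ^ 2 + τ * ((2 * C + C ^ 2) * b ^ 2) := by
    have s1 := pow_le_pow_left₀ hx' h1 2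
    have s2 : τ * (C * b) * x ≤ τ * (C * b) * b := mul_le_mul_of_nonneg_left bx (by positivity)
    have s3 : τ * (τ * (C * b) ^ 2) ≤ 1 * (τ * (C * b) ^ 2) :=
      mul_le_mul_of_nonneg_right hτ1 (by positivity)
    nlinarith
  have a2 : σ' ^ 2 ≤ σ ^ 2 + τ * ((2 * C ^ 2 + 2 * C + 2 * C ^ 2) * b ^ 2) + τ * D ^ 2 := by
    have s1 := pow_le_pow_left₀ hσ' h3 2
    have s2 : τ * C * b * σ ≤ τ * C * b * b := mul_le_mul_of_nonneg_left bσ (by positivity)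
    have s3 : τ * C * D * σ ≤ τ * C * D * b := mul_le_mul_of_nonneg_left bσ (by positivity)
    -- Young's inequality
    have s4 : 2 * (τ * C * D * b) ≤ τ * (2 * C ^ 2 * b ^ 2 + D ^ 2 / 2) := by
      have := mul_nonneg hτ.le (sq_nonneg (2 * (C * b) - D))
      linarith
    have s5 : τ ^ 2 * (C * D + C * b) ^ 2 ≤ τ ^ 2 * (2 * (C * D) ^ 2 + 2 * (C * b) ^ 2) := by
      refine mul_le_mul_of_nonneg_left ?_ (sq_nonneg τ)
      linarith [sq_nonneg (C * D - C * b)]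
    have s6 : τ * (4 * C ^ 2 * τ) * D ^ 2 ≤ τ * 1 * D ^ 2 :=
      mul_le_mul_of_nonneg_right (mul_le_mul_of_nonneg_left hτC hτ.le) (sq_nonneg D)
    have s7 : τ * (τ * (C * b) ^ 2) ≤ 1 * (τ * (C * b) ^ 2) :=
      mul_le_mul_of_nonneg_right hτ1 (by positivity)
    have e1 : (σ + τ * (C * D + C * b)) ^ 2 = σ ^ 2 + 2 * (τ * C * D * σ) + 2 * (τ * C * b * σ)
      + τ ^ 2 * (C * D + C * b) ^ 2 := by ring
    linarith
  have a3 : b ^ 2 ≤ 3 * (x ^ 2 + E * G + σ ^ 2 + ρ ^ 2) := by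
    rw [hb]
    nlinarith [sq_nonneg (x - σ), sq_nonneg (x - ρ), sq_nonneg (σ - ρ)]
  have a4 : τ * ((4 * C + 6 * C ^ 2) * b ^ 2)
      ≤ τ * ((4 * C + 8 * C ^ 2) * (3 * (x ^ 2 + E * G + σ ^ 2 + ρ ^ 2))) := by
    have : 0 ≤ C ^ 2 := sq_nonneg C
    refine mul_le_mul_of_nonneg_left (mul_le_mul ?_ a3 (sq_nonneg b) (by positivity)) hτ.le
    linarith
  linarith

/-! ### Convergence -/

theorem abs_add_mem_Icc {U v β δ : ℝ} (hU : |U| ≤ β) (hv : |v - U| ≤ δ) :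
    v ∈ Icc (-(β + δ)) (β + δ) := by
  rw [abs_le] at hU hv
  constructor <;> linarith [hU.1, hU.2, hv.1, hv.2]

/-- Convergence under the step restriction `τ ≤ h² / ε²`, with a constant chosen before the
nonlinearity; only the thresholds for `τ` and `h` depend on `f`, `F`, `β` and the margin `δ`. -/
theorem exists_error_bound (L T ε κ K : ℝ) (hL : 0 < L) (hT : 0 < T) (hε : 0 < ε) (hκ : 0 ≤ κ)
    (hK : 0 ≤ K) (u_e : ℝ → ℝ → ℝ → ℝ) (hu : IsSmoothPeriodic L T u_e) :
    ∃ C : ℝ, 0 < C ∧ ∀ (β δ : ℝ) (f F : ℝ → ℝ), 0 < β → 0 < δ → IsTameOn K (β + δ) f F →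
      (∀ t ∈ Icc 0 T, ∀ x y, |u_e t x y| ≤ β) → SolvesReactionDiffusion T ε f u_e →
      ∃ τ₀ : ℝ, 0 < τ₀ ∧ ∃ h₀ : ℝ, 0 < h₀ ∧
        ∀ (M : ℕ) [NeZero M] (h τ : ℝ), h = L / M → h ≤ h₀ → 0 < τ → τ ≤ τ₀ →
          τ ≤ h ^ 2 / ε ^ 2 →
          ∀ (u : ℕ → GridFn M) (s : ℕ → ℝ) (uh : ℕ → GridFn M) (sh : ℕ → ℝ),
            IsSESAV2 h τ ε κ f F (restrict M h (u_e 0)) u s uh sh →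
            ∀ n : ℕ, n * τ ≤ T →
              dNorm h (u n - restrict M h (u_e (n * τ)))
                + dGradNorm h (u n - restrict M h (u_e (n * τ)))
                + |s n - potentialEnergy L F (u_e (n * τ))| ≤ C * (τ ^ 2 + h ^ 2) := by
  obtain ⟨B, hB0, hB⟩ := hu.exists_partials_bound hL hT
  have hA := truncationConst_nonneg (ε := ε) hB0 hK
  set A := truncationConst B K ε
  obtain ⟨C₁, hC₁, hpred⟩ := exists_predictor_const hL.le hκ hK hA
  obtain ⟨C₂, hC₂, hcorr⟩ := exists_corrector_const hL.le hκ hK hA hC₁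
  set Γ := 12 * (C₂ + 2 * C₂ ^ 2) with hΓ
  have hΓ0 : 0 ≤ Γ := by positivity
  set W := Real.exp (Γ * T) with hW
  have hW1 : 1 ≤ W := Real.one_le_exp (by positivity)
  set Q := 2 * L ^ 2 * (2 * K * B * (1 + B)) with hQ
  have hQ0 : 0 ≤ Q := by positivity
  refine ⟨2 * W + W / ε + Q, by positivity, ?_⟩
  intro β δ f F hβ hδ hf hmax hpde
  set a := β + δ with ha
  have ha0 : 0 ≤ a := by positivity
  have hua : ∀ t ∈ Icc 0 T, ∀ x y, u_e t x y ∈ Icc (-a) a := fun t ht x y => by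
    have := abs_le.1 (hmax t ht x y)
    exact ⟨by linarith [this.1], by linarith [this.2]⟩
  set P := 3 * W * C₁ * (1 / ε ^ 2 + 1) with hP
  have hP0 : 0 < P := by positivity
  have hKL : 0 < K * L + 1 := by positivity
  refine ⟨min 1 (1 / (4 * C₂ ^ 2 + 1)), by positivity,
    min 1 (min (δ / P) (1 / ((K * L + 1) * P))), by positivity, ?_⟩
  intro M _ h τ hh hh₀ hτ hτ₀ hcfl u s uh sh hs
  have hM : (0 : ℝ) < M := Nat.cast_pos.2 (Nat.pos_of_ne_zero (NeZero.ne M))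
  have hhpos : 0 < h := by rw [hh]; positivity
  have hLh : L = M * h := by rw [hh]; field_simp
  have hh1 : h ≤ 1 := hh₀.trans (min_le_left _ _)
  have hPδ : P * h ≤ δ := by
    have := hh₀.trans ((min_le_right _ _).trans (min_le_left _ _))
    rw [le_div_iff₀ hP0] at this
    linarith
  have hPK : (K * L + 1) * (P * h) ≤ 1 := by
    have := hh₀.trans ((min_le_right _ _).trans (min_le_right _ _))
    rw [le_div_iff₀ (by positivity)] at this
    linarith
  have hτ1 : τ ≤ 1 := hτ₀.trans (min_le_left _ _)
  have hτC : 4 * C₂ ^ 2 * τ ≤ 1 := by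
    have := hτ₀.trans (min_le_right _ _)
    rw [le_div_iff₀ (by positivity)] at this
    linarith
  set ρ := τ ^ 2 + h ^ 2 with hρ
  have hρ0 : 0 ≤ ρ := by positivity
  -- the mesh condition makes `ρ` small compared with `h`
  have hρh : 3 * W * C₁ * ρ ≤ P * h * h := by
    have h1 : τ ^ 2 ≤ h ^ 2 / ε ^ 2 := by
      refine le_trans ?_ hcfl
      rw [sq]
      exact mul_le_of_le_one_left hτ.le hτ1
    have h2 : ρ ≤ (1 / ε ^ 2 + 1) * (h * h) := by
      rw [hρ]
      calc _ ≤ h ^ 2 / ε ^ 2 + h ^ 2 := by linarith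
        _ = _ := by ring
    have := mul_le_mul_of_nonneg_left h2 (by positivity : 0 ≤ 3 * W * C₁)
    rw [hP]
    linarith
  have hρh' : 3 * W * C₁ * ρ ≤ P * h :=
    hρh.trans (mul_le_of_le_one_right (by positivity) hh1)
  set U : ℕ → GridFn M := fun n => restrict M h (u_e (n * τ)) with hU
  set e : ℕ → GridFn M := fun n => u n - U n with he
  set σ : ℕ → ℝ := fun n => |s n - dPotentialEnergy h F (U n)| with hσ
  set Y : ℕ → ℝ := fun n => dNorm h (e n) ^ 2 + ε ^ 2 * dGradNorm h (e n) ^ 2 + σ n ^ 2 with hY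
  have hσ0 : ∀ n, 0 ≤ σ n := fun n => abs_nonneg _
  have hexp : ∀ n : ℕ, n * τ ≤ T → (1 + τ * Γ) ^ n ≤ W := by
    intro n hn
    calc (1 + τ * Γ) ^ n ≤ Real.exp (τ * Γ) ^ n := by
          refine pow_le_pow_left₀ (by positivity) ?_ n
          linarith [Real.add_one_le_exp (τ * Γ)]
      _ = Real.exp (Γ * (n * τ)) := by rw [← Real.exp_nat_mul]; congr 1; ring
      _ ≤ W := Real.exp_le_exp.2 (mul_le_mul_of_nonneg_left hn hΓ0)
  have hsqW : W * ρ ^ 2 ≤ (W * ρ) ^ 2 := by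
    rw [mul_pow]
    refine mul_le_mul_of_nonneg_right ?_ (sq_nonneg ρ)
    rw [sq]; exact le_mul_of_one_le_left (by positivity) hW1
  have hparts : ∀ n : ℕ, n * τ ≤ T → Y n + ρ ^ 2 ≤ (1 + τ * Γ) ^ n * ρ ^ 2 →
      dNorm h (e n) ≤ W * ρ ∧ ε * dGradNorm h (e n) ≤ W * ρ ∧ σ n ≤ W * ρ := by
    intro n hn hYn
    have h1 : Y n ≤ (W * ρ) ^ 2 := by
      have := mul_le_mul_of_nonneg_right (hexp n hn) (sq_nonneg ρ)
      linarith [sq_nonneg ρ]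
    have hWρ : 0 ≤ W * ρ := by positivity
    have y1 := sq_nonneg (dNorm h (e n))
    have y2 := sq_nonneg (ε * dGradNorm h (e n))
    have y3 := sq_nonneg (σ n)
    have e2 : (ε * dGradNorm h (e n)) ^ 2 = ε ^ 2 * dGradNorm h (e n) ^ 2 := mul_pow _ _ _
    simp only [hY] at h1
    refine ⟨?_, ?_, ?_⟩ <;> refine abs_le_of_sq_le_sq' ?_ hWρ |>.2 <;> linarith
  have main : ∀ n : ℕ, n * τ ≤ T → Y n + ρ ^ 2 ≤ (1 + τ * Γ) ^ n * ρ ^ 2 := by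
    intro n
    induction n with
    | zero =>
      intro _
      have e0 : e 0 = 0 := by simp only [he, hU, hs.init_u]; simp
      have s0 : σ 0 = 0 := by simp only [hσ, hU, hs.init_s, hs.init_u]; simp
      have n0 : dNorm h (0 : GridFn M) = 0 := by simp [dNorm, dInner]
      have g0 : dGradNorm h (0 : GridFn M) = 0 := by
        simp [dGradNorm, dInner, dGradX, dGradY]
      simp only [hY, e0, s0, n0, g0]
      simp
    | succ n ih =>
      intro hn
      have hnn : (n : ℝ) * τ + τ ≤ T := by push_cast at hn; linarith
      have hn0 : 0 ≤ (n : ℝ) * τ := by positivity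
      have hn' : (n : ℝ) * τ ≤ T := by linarith
      have hIH := ih hn'
      obtain ⟨p1, -, p3⟩ := hparts n hn' hIH
      set b := dNorm h (e n) + σ n + ρ with hb
      have hx0 : 0 ≤ dNorm h (e n) := dNorm_nonneg _
      have hρW : ρ ≤ W * ρ := le_mul_of_one_le_left hρ0 hW1
      have hb3 : b ≤ 3 * W * ρ := by linarith
      have hb0 : 0 ≤ b := by have := hσ0 n; positivity
      have hCb : C₁ * b ≤ P * h * h := by
        have := mul_le_mul_of_nonneg_left hb3 (by linarith : 0 ≤ C₁)
        linarith
      have hCb' : C₁ * b ≤ P * h := by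
        have := mul_le_mul_of_nonneg_left hb3 (by linarith : 0 ≤ C₁)
        linarith
      have hbC : b ≤ C₁ * b := le_mul_of_one_le_left hb0 hC₁
      have hsm : (K * L + 1) * (C₁ * b) ≤ 1 :=
        (mul_le_mul_of_nonneg_left hCb' hKL.le).trans hPK
      have hsm' : (K * L + 1) * b ≤ 1 := (mul_le_mul_of_nonneg_left hbC hKL.le).trans hsm
      have hb1 : b ≤ 1 := by
        have : 0 ≤ K * L * b := by positivity
        linarith
      -- the inverse inequality keeps the numerical solution close to `[-β, β]`
      have hnear : ∀ (v V : GridFn M), (∀ p, |V p| ≤ β) → dNorm h (v - V) ≤ C₁ * b →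
          ∀ p, v p ∈ Icc (-a) a := by
        intro v V hV hv p
        refine abs_add_mem_Icc (hV p) ((abs_apply_le_dNorm_div hhpos (v - V) p).trans ?_)
        rw [div_le_iff₀ hhpos]
        exact (hv.trans hCb).trans (mul_le_mul_of_nonneg_right hPδ hhpos.le)
      have eU1 : restrict M h (u_e (n * τ + τ)) = U (n + 1) := by
        simp only [hU]; congr 2; push_cast; ring
      have hstep : IsStep L h τ ε κ K a A f F (U n) (restrict M h (u_e (n * τ + τ / 2)))
          (U (n + 1)) (u n) (uh n) (u (n + 1)) (s n) (sh n) (s (n + 1)) :=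
        { length := hLh
          mesh_pos := hhpos
          time_pos := hτ
          time_le := hτ1
          radius_nonneg := ha0
          tame := hf
          consistent := by
            rw [← eU1]
            exact isConsistent_restrict hT hu hpde ha0 hf hua hB hLh hhpos hτ hn0 hnn
          mem_start := fun p => hua _ ⟨hn0, hn'⟩ _ _
          mem_half := fun p => hua _ ⟨by linarith, by linarith⟩ _ _
          predictor_u := hs.predictor_u n
          predictor_s := hs.predictor_s n
          corrector_u := hs.corrector_u n
          corrector_s := hs.corrector_s n }
      have hxb : dNorm h (u n - U n) ≤ b := by
        have := hσ0 n
        change dNorm h (e n) ≤ b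
        linarith
      have hσb : |s n - dPotentialEnergy h F (U n)| ≤ b := by
        change σ n ≤ b
        linarith
      have hρb : τ ^ 2 + h ^ 2 ≤ b := by
        have := hσ0 n
        change ρ ≤ b
        linarith
      obtain ⟨q1, q2⟩ := hpred M h τ ε a b f F _ _ _ _ _ _ _ _ _ hstep
        (hnear _ _ (fun p => hmax _ ⟨hn0, hn'⟩ _ _) (hxb.trans hbC)) hxb hσb hρb hsm'
      obtain ⟨D, hD0, r1, r2, r3⟩ := hcorr M h τ ε a b f F _ _ _ _ _ _ _ _ _ hstep
        (hnear _ _ (fun p => hmax _ ⟨by linarith, by linarith⟩ _ _) q1) hxb hρb hb1 q1 q2 hsm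
      have hY1 : Y (n + 1) ≤ Y n + τ * (Γ * (Y n + ρ ^ 2)) :=
        sq_step_le hC₂ hτ hτ1 hτC hx0 (dNorm_nonneg _) (hσ0 n) (hσ0 (n + 1)) hρ0 hD0 hb r1 r2 r3
          (by positivity)
      have : (1 + τ * Γ) * (Y n + ρ ^ 2) ≤ (1 + τ * Γ) * ((1 + τ * Γ) ^ n * ρ ^ 2) :=
        mul_le_mul_of_nonneg_left hIH (by positivity)
      calc Y (n + 1) + ρ ^ 2 ≤ (1 + τ * Γ) * (Y n + ρ ^ 2) := by linarith
        _ ≤ _ := this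
        _ = _ := by rw [pow_succ]; ring
  intro n hn
  obtain ⟨p1, p2, p3⟩ := hparts n hn (main n hn)
  have hq := abs_dPotentialEnergy_restrict_sub_le hT hu ha0 hf hua hB hLh hhpos
    (t := n * τ) ⟨by positivity, hn⟩
  have p2' : dGradNorm h (e n) ≤ W / ε * ρ := by
    rw [div_mul_eq_mul_div, le_div_iff₀ hε]
    linarith
  have p4 : |s n - potentialEnergy L F (u_e (n * τ))| ≤ W * ρ + Q * ρ := by
    refine (abs_sub_le _ (dPotentialEnergy h F (U n)) _).trans (add_le_add p3 (hq.trans ?_))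
    refine mul_le_mul_of_nonneg_left ?_ hQ0
    rw [hρ]
    exact le_add_of_nonneg_left (sq_nonneg τ)
  calc _ ≤ W * ρ + W / ε * ρ + (W * ρ + Q * ρ) := add_le_add (add_le_add p1 p2') p4
    _ = _ := by ring

end SESAV

theorem mainTheorem6
    (L T ε κ Cstar K : ℝ) (hL : 0 < L) (hT : 0 < T) (hε : 0 < ε) (hCstar : 0 ≤ Cstar)
    (u_e : ℝ → ℝ → ℝ → ℝ) (hu_e : SESAV.IsSmoothPeriodic L T u_e) :
    -- the constant depends on `Cstar, L, T, u_e, κ, ε` and the bound `K` of the `C¹` norm of `f`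
    ∃ C : ℝ, 0 < C ∧
      ∀ (β : ℝ) (f F : ℝ → ℝ) (J : Set ℝ), 0 < β →
        IsOpen J → Set.Icc (-β) β ⊆ J →
        ContDiffOn ℝ 1 f J → (∀ ξ ∈ J, HasDerivAt F (-f ξ) ξ) →
        f β ≤ 0 → 0 ≤ f (-β) →
        (∀ ξ ∈ Set.Icc (-β) β, |f ξ| ≤ K ∧ |deriv f ξ| ≤ K) →
        (∀ ξ ∈ Set.Icc (-β) β, -Cstar ≤ L ^ 2 * F ξ) →
        (∀ ξ ∈ Set.Icc (-β) β, |deriv f ξ| ≤ κ) →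
        SESAV.SolvesReactionDiffusion T ε f u_e →
        (∀ x y, |u_e 0 x y| ≤ β) →
        ∃ τ₀ : ℝ, 0 < τ₀ ∧ ∃ h₀ : ℝ, 0 < h₀ ∧
          ∀ (M : ℕ) [NeZero M] (h τ : ℝ), h = L / M → h ≤ h₀ → 0 < τ → τ ≤ τ₀ →
            τ ≤ (κ * SESAV.gUpper L ε Cstar F (u_e 0) / 2 + ε ^ 2 / h ^ 2)⁻¹ →
            ∀ (u : ℕ → SESAV.GridFn M) (s : ℕ → ℝ) (uh : ℕ → SESAV.GridFn M) (sh : ℕ → ℝ),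
              SESAV.IsSESAV2 h τ ε κ f F (SESAV.restrict M h (u_e 0)) u s uh sh →
              ∀ n : ℕ, n ≤ ⌊T / τ⌋₊ →
                SESAV.dNorm h (u n - SESAV.restrict M h (u_e (n * τ)))
                  + SESAV.dGradNorm h (u n - SESAV.restrict M h (u_e (n * τ)))
                  + |s n - SESAV.potentialEnergy L F (u_e (n * τ))|
                  ≤ C * (τ ^ 2 + h ^ 2) := by
  by_cases hsign : 0 ≤ κ ∧ 0 ≤ K
  · obtain ⟨C, hC, H⟩ := SESAV.exists_error_bound L T ε κ (K + 1) hL hT hε hsign.1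
      (by linarith [hsign.2]) u_e hu_e
    refine ⟨C, hC, ?_⟩
    intro β f F J hβ hJ hβJ hf hF hfβ hfβ' hK _ _ hpde h0
    obtain ⟨δ, hδ, htame⟩ := SESAV.exists_isTameOn hβ hJ hβJ hf hF hK
    have hmax := hpde.maximum_bound hL hT hβ hδ hu_e htame hfβ hfβ' h0
    obtain ⟨τ₀, hτ₀, h₀, hh₀, H'⟩ := H β δ f F hβ hδ htame hmax hpde
    refine ⟨τ₀, hτ₀, h₀, hh₀, ?_⟩
    intro M _ h τ hh hle hτ hτle hcfl u s uh sh hs n hn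
    have hM : (0 : ℝ) < M := Nat.cast_pos.2 (Nat.pos_of_ne_zero (NeZero.ne M))
    have hhpos : 0 < h := by rw [hh]; positivity
    have hcfl' : τ ≤ h ^ 2 / ε ^ 2 := by
      have hG : 0 ≤ κ * SESAV.gUpper L ε Cstar F (u_e 0) / 2 :=
        div_nonneg (mul_nonneg hsign.1 (Real.exp_pos _).le) zero_le_two
      refine hcfl.trans ?_
      rw [← inv_div (ε ^ 2) (h ^ 2)]
      exact inv_anti₀ (div_pos (pow_pos hε 2) (pow_pos hhpos 2)) (le_add_of_nonneg_left hG)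
    refine H' M h τ hh hle hτ hτle hcfl' u s uh sh hs n ?_
    rw [← le_div_iff₀ hτ]
    exact (Nat.le_floor_iff (by positivity)).1 hn
  · -- no nonlinearity satisfies the bounds at `ξ = 0`
    refine ⟨1, one_pos, ?_⟩
    intro β f F J hβ _ _ _ _ _ _ hK _ hκ
    have h0 : (0 : ℝ) ∈ Set.Icc (-β) β := ⟨by linarith, hβ.le⟩
    exact absurd ⟨(abs_nonneg _).trans (hκ 0 h0), (abs_nonneg _).trans (hK 0 h0).1⟩ hsign
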